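/- Let $K$ be a field and $n\ge 3$. Supercommutative $K$-algebras are $\mathbb Z/2$-graded $K$-algebras $\mathcal R=\mathcal R_{\bar 0}\oplus\mathcal R_{\bar 1}$ in which even elements are central and odd elements anticommute and have square zero; an affine algebraic supervariety is given by its supercommutative algebra of regular functions, a quotient of some $K[x_1,\dots,x_p\,|\,\xi_1,\dots,\xi_q]$ ($x_i$ even, $\xi_j$ odd) by a graded ideal. It has dimension $p|q$ if its algebra of functions $A$ satisfies $\dim A_{\bar 0}=p$ (Krull dimension) and $q$ is the largest $s$ for which there are $y_1,\dots,y_s\in A_{\bar 1}$ with $\dim A_{\bar 0}/\mathrm{Ann}_{A_{\bar 0}}(y_1\cdots y_s)=\dim A_{\bar 0}$ (Krull superdimension). Codimension means difference of dimensions. For a supercommutative $K$-algebra $\mathcal R$, a potential consists of $a_i\in\mathcal R_{\bar 0}$, $\beta_i\in\mathcal R_{\bar 1}$ $(i\in\mathbb Z)$ with $a_{i+n}=a_i$ and $\beta_{i+n}=-\beta_i$. A solution of the corresponding equation is a pair of sequences $V_i,W_i\in\mathcal R$ $(i\in\mathbb Z)$ with $$V_i=a_iV_{i-1}-V_{i-2}-\beta_iW_{i-1},\qquad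 W_i=W_{i-1}+\beta_iV_{i-1}\qquad(i\in\mathbb Z),$$ and the equation is a supersymmetric Hill equation if all its solutions satisfy $V_{i+n}=-V_i$ and $W_{i+n}=W_i$ for all $i$. Let $$A_i=\begin{pmatrix}0&1&0\\-1&a_i&-\beta_i\\0&\beta_i&1\end{pmatrix},\qquad M_i=A_{i+n-1}\cdots A_{i+1}A_i .$$ (1) The potentials over $\mathcal R$ are the $\mathcal R$-points of the supervariety with algebra of functions $K[a_1,\dots,a_n\,|\,\beta_1,\dots,\beta_n]$, which has dimension $n|n$. (2) For every potential over every supercommutative $K$-algebra $\mathcal R$ and every $i\in\mathbb Z$, the equation is a supersymmetric Hill equation if and only if $M_i=\mathrm{diag}(-1,-1,1)$. (3) The supersymmetric Hill equations form an algebraic supervariety $\mathcal E_n$: if $I$ is the ideal of $K[a_1,\dots,a_n\,|\,\beta_1,\dots,\beta_n]$ generated by the entries of $M_1-\mathrm{diag}(-1,-1,1)$, then for every supercommutative $K$-algebra $\mathcal R$ the even $K$-algebra homomorphisms $K[a_1,\dots,a_n\,|\,\beta_1,\dots,\beta_n]/I\to\mathcal R$ correspond bijectively, through the images of the $a_i$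 and $\beta_i$, to the supersymmetric Hill equations over $\mathcal R$. (4) $\mathcal E_n$ has dimension $(n-3)|(n-2)$, that is, codimension $3|2$ in the $n|n$-dimensional space of potentials. -/

import Mathlib

universe u v

open DirectSum

noncomputable section

/-! ## Supercommutative algebras -/

/-- A `ℤ/2`-graded `K`-algebra is supercommutative: even elements are central, odd elements
anticommute and have square zero. (The last condition follows from the second one unless `2` is
a zero divisor.) -/
class IsSupercommutative {K : Type u} [Field K] {R : Type v} [Ring R] [Algebra K R]
    (𝓡 : ZMod 2 → Submodule K R) : Prop where
  even_comm : ∀ x ∈ 𝓡 0, ∀ y : R, x * y = y * x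
  odd_anticomm : ∀ x ∈ 𝓡 1, ∀ y ∈ 𝓡 1, x * y = -(y * x)
  odd_sq : ∀ x ∈ 𝓡 1, x * x = 0

/-- The even part of a supercommutative algebra is a commutative ring. -/
instance evenPartCommRing {K : Type u} [Field K] {R : Type v} [Ring R] [Algebra K R]
    (𝓡 : ZMod 2 → Submodule K R) [GradedAlgebra 𝓡] [IsSupercommutative 𝓡] :
    CommRing (𝓡 0) :=
  { SetLike.GradeZero.instRing 𝓡 with
    mul_comm := fun x y => Subtype.ext (IsSupercommutative.even_comm (𝓡 := 𝓡) x.1 x.2 y.1) }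

/-! ## Krull superdimension -/

/-- The annihilator of an element `z` in the even part. -/
def evenAnnihilator {K : Type u} [Field K] {R : Type v} [Ring R] [Algebra K R]
    (𝓡 : ZMod 2 → Submodule K R) [GradedAlgebra 𝓡] [IsSupercommutative 𝓡] (z : R) :
    Ideal (𝓡 0) where
  carrier := {x | (x : R) * z = 0}
  add_mem' := by
    intro x y hx hy
    have hx' : (x : R) * z = 0 := hx
    have hy' : (y : R) * z = 0 := hy
    change ((x : R) + (y : R)) * z = 0
    rw [add_mul, hx', hy', add_zero]
  zero_mem' := by
    change (0 : R) * z = 0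
    exact zero_mul z
  smul_mem' := by
    intro c x hx
    have hx' : (x : R) * z = 0 := hx
    change ((c : R) * (x : R)) * z = 0
    rw [mul_assoc, hx', mul_zero]

/-- Odd elements `y₁, …, y_s` form a system of odd parameters if the annihilator of
`y₁ ⋯ y_s` in the even part `R₀` satisfies `dim R₀ / Ann = dim R₀`. -/
def IsOddParameterSystem {K : Type u} [Field K] {R : Type v} [Ring R] [Algebra K R]
    (𝓡 : ZMod 2 → Submodule K R) [GradedAlgebra 𝓡] [IsSupercommutative 𝓡] {s : ℕ}
    (y : Fin s → R) : Prop :=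
  (∀ i, y i ∈ 𝓡 1) ∧
    ringKrullDim (𝓡 0 ⧸ evenAnnihilator 𝓡 (List.ofFn y).prod) = ringKrullDim (𝓡 0)

/-- The (Krull) superdimension of the affine supervariety with superalgebra of functions `R` is
`p|q`: the even part `R₀` has Krull dimension `p`, and `q` is the largest length of a system of
odd parameters. -/
def HasSuperdimension {K : Type u} [Field K] {R : Type v} [Ring R] [Algebra K R]
    (𝓡 : ZMod 2 → Submodule K R) [GradedAlgebra 𝓡] [IsSupercommutative 𝓡] (p q : ℕ) : Prop :=
  ringKrullDim (𝓡 0) = (p : WithBot ℕ∞) ∧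
    IsGreatest {s : ℕ | ∃ y : Fin s → R, IsOddParameterSystem 𝓡 y} q

/-- A closed sub-supervariety (with superalgebra of functions `A`) of an affine supervariety
(with superalgebra of functions `S`) has codimension `c|d` if the superdimensions of the two
differ by `c|d`. -/
def HasSupercodimension {K : Type u} [Field K] {S : Type v} [Ring S] [Algebra K S]
    (𝓢 : ZMod 2 → Submodule K S) [GradedAlgebra 𝓢] [IsSupercommutative 𝓢]
    {A : Type v} [Ring A] [Algebra K A]
    (𝓐 : ZMod 2 → Submodule K A) [GradedAlgebra 𝓐] [IsSupercommutative 𝓐] (c d : ℕ) : Prop :=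
  ∃ p q : ℕ, HasSuperdimension 𝓢 (p + c) (q + d) ∧ HasSuperdimension 𝓐 p q

/-! ## Quotient of a superalgebra by the graded ideal generated by a set -/

section Quotient

variable {K : Type u} [Field K] {S : Type v} [Ring S] [Algebra K S]
  (𝓢 : ZMod 2 → Submodule K S) [GradedAlgebra 𝓢] (G : Set S)

/-- The relations `g_i = 0` for all homogeneous components `g_i` of all elements `g` of `G`. -/
def superRel (x y : S) : Prop :=
  y = 0 ∧ ∃ g ∈ G, ∃ i : ZMod 2, x = (decompose 𝓢 g i : S)

/-- The quotient of `S` by the smallest `ℤ/2`-graded two-sided ideal containing `G`. -/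
abbrev SuperQuot : Type v := RingQuot (superRel 𝓢 G)

/-- The quotient map. -/
def superQuotMk : S →ₐ[K] SuperQuot 𝓢 G := RingQuot.mkAlgHom K (superRel 𝓢 G)

/-- The grading of the quotient: images of the homogeneous parts. -/
def superQuotGrading (i : ZMod 2) : Submodule K (SuperQuot 𝓢 G) :=
  (𝓢 i).map (superQuotMk 𝓢 G).toLinearMap

theorem superQuotMk_mem {i : ZMod 2} {x : S} (hx : x ∈ 𝓢 i) :
    superQuotMk 𝓢 G x ∈ superQuotGrading 𝓢 G i :=
  Submodule.mem_map_of_mem hx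

theorem superQuotMk_surjective : Function.Surjective (superQuotMk 𝓢 G) :=
  RingQuot.mkAlgHom_surjective K (superRel 𝓢 G)

theorem superQuotMk_component {g : S} (hg : g ∈ G) (i : ZMod 2) :
    superQuotMk 𝓢 G (decompose 𝓢 g i : S) = 0 := by
  have h := RingQuot.mkAlgHom_rel (S := K) (s := superRel 𝓢 G)
    (x := (decompose 𝓢 g i : S)) (y := 0) ⟨rfl, g, hg, i, rfl⟩
  simpa [superQuotMk] using h

instance superQuotGradedMonoid : SetLike.GradedMonoid (superQuotGrading 𝓢 G) where
  one_mem := by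
    have h := superQuotMk_mem 𝓢 G (SetLike.GradedOne.one_mem (A := 𝓢))
    rwa [map_one] at h
  mul_mem := by
    rintro i j _ _ ⟨x, hx, rfl⟩ ⟨y, hy, rfl⟩
    have h := superQuotMk_mem 𝓢 G (SetLike.GradedMul.mul_mem (A := 𝓢) hx hy)
    rwa [map_mul] at h

/-- The quotient map, from homogeneous parts to homogeneous parts. -/
def superQuotPiece (i : ZMod 2) : 𝓢 i →ₗ[K] superQuotGrading 𝓢 G i :=
  (superQuotMk 𝓢 G).toLinearMap.restrict (fun _ hx => superQuotMk_mem 𝓢 G hx)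

/-- The quotient map on direct sums of homogeneous parts. -/
def superQuotSum : (⨁ i, 𝓢 i) →ₐ[K] ⨁ i, superQuotGrading 𝓢 G i :=
  DirectSum.toAlgebra K (fun i => 𝓢 i)
    (fun i => (DirectSum.lof K (ZMod 2) (fun i => superQuotGrading 𝓢 G i) i).comp
      (superQuotPiece 𝓢 G i))
    (by
      change DirectSum.of (fun i => superQuotGrading 𝓢 G i) 0 _ = 1
      rw [DirectSum.one_def]
      congr 1
      exact Subtype.ext (map_one (superQuotMk 𝓢 G)))
    (by
      intro i j ai aj
      change DirectSum.of (fun i => superQuotGrading 𝓢 G i) (i + j) _ =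
        DirectSum.of (fun i => superQuotGrading 𝓢 G i) i _ *
        DirectSum.of (fun i => superQuotGrading 𝓢 G i) j _
      rw [DirectSum.of_mul_of]
      congr 1
      exact Subtype.ext (map_mul (superQuotMk 𝓢 G) _ _))

theorem superQuotSum_of (i : ZMod 2) (x : 𝓢 i) :
    superQuotSum 𝓢 G (DirectSum.of (fun i => 𝓢 i) i x) =
      DirectSum.of (fun i => superQuotGrading 𝓢 G i) i (superQuotPiece 𝓢 G i x) :=
  DirectSum.toAddMonoid_of
    (fun i => ((DirectSum.lof K (ZMod 2) (fun i => superQuotGrading 𝓢 G i) i).comp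
      (superQuotPiece 𝓢 G i)).toAddMonoidHom) i x

/-- The decomposition of an element of the quotient into homogeneous components. -/
def superQuotDecompose : SuperQuot 𝓢 G →ₐ[K] ⨁ i, superQuotGrading 𝓢 G i :=
  RingQuot.liftAlgHom K
    ⟨(superQuotSum 𝓢 G).comp (DirectSum.decomposeAlgEquiv 𝓢).toAlgHom, by
      rintro _ _ ⟨rfl, g, hg, i, rfl⟩
      rw [map_zero]
      change superQuotSum 𝓢 G (decompose 𝓢 (decompose 𝓢 g i : S)) = 0
      rw [decompose_coe, superQuotSum_of]
      have h : superQuotPiece 𝓢 G i (decompose 𝓢 g i) = 0 :=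
        Subtype.ext (superQuotMk_component 𝓢 G hg i)
      rw [h, map_zero]⟩

theorem superQuotDecompose_mk (x : S) :
    superQuotDecompose 𝓢 G (superQuotMk 𝓢 G x) = superQuotSum 𝓢 G (decompose 𝓢 x) :=
  RingQuot.liftAlgHom_mkAlgHom_apply _ _ _ _

instance superQuotGradedAlgebra : GradedAlgebra (superQuotGrading 𝓢 G) :=
  GradedAlgebra.ofAlgHom _ (superQuotDecompose 𝓢 G)
    (by
      refine AlgHom.ext fun y => ?_
      obtain ⟨x, rfl⟩ := superQuotMk_surjective 𝓢 G y
      change DirectSum.coeAlgHom _ (superQuotDecompose 𝓢 G (superQuotMk 𝓢 G x)) =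
        superQuotMk 𝓢 G x
      rw [superQuotDecompose_mk]
      induction x using DirectSum.Decomposition.inductionOn 𝓢 with
      | zero => simp
      | homogeneous m =>
        rw [decompose_coe, superQuotSum_of, DirectSum.coeAlgHom_of]
        rfl
      | add m m' h h' => rw [decompose_add, map_add, map_add, map_add, h, h'])
    (by
      rintro i ⟨_, x, hx, rfl⟩
      change superQuotDecompose 𝓢 G (superQuotMk 𝓢 G x) = _
      rw [superQuotDecompose_mk, decompose_of_mem 𝓢 hx, superQuotSum_of]
      rfl)

instance superQuotSupercommutative [IsSupercommutative 𝓢] :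
    IsSupercommutative (superQuotGrading 𝓢 G) where
  even_comm := by
    rintro _ ⟨x, hx, rfl⟩ y
    obtain ⟨y, rfl⟩ := superQuotMk_surjective 𝓢 G y
    change superQuotMk 𝓢 G x * superQuotMk 𝓢 G y = superQuotMk 𝓢 G y * superQuotMk 𝓢 G x
    rw [← map_mul, ← map_mul, IsSupercommutative.even_comm (𝓡 := 𝓢) x hx y]
  odd_anticomm := by
    rintro _ ⟨x, hx, rfl⟩ _ ⟨y, hy, rfl⟩
    change superQuotMk 𝓢 G x * superQuotMk 𝓢 G y = -(superQuotMk 𝓢 G y * superQuotMk 𝓢 G x)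
    rw [← map_mul, ← map_mul, IsSupercommutative.odd_anticomm (𝓡 := 𝓢) x hx y hy, map_neg]
  odd_sq := by
    rintro _ ⟨x, hx, rfl⟩
    change superQuotMk 𝓢 G x * superQuotMk 𝓢 G x = 0
    rw [← map_mul, IsSupercommutative.odd_sq (𝓡 := 𝓢) x hx, map_zero]

end Quotient

/-! ## The polynomial superalgebra of potentials -/

/-- The superalgebra `K[a₁, …, aₙ | β₁, …, βₙ]`, with indices taken modulo `n`: the exterior
algebra of a free module with basis `β` over the polynomial ring in the variables `a`. -/
abbrev PotentialAlgebra (K : Type u) [Field K] (n : ℕ) : Type u :=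
  ExteriorAlgebra (MvPolynomial (ZMod n) K) (ZMod n →₀ MvPolynomial (ZMod n) K)

/-- The even and odd parts of `K[a₁, …, aₙ | β₁, …, βₙ]`. -/
abbrev potentialGrading (K : Type u) [Field K] (n : ℕ) (i : ZMod 2) :
    Submodule K (PotentialAlgebra K n) :=
  (CliffordAlgebra.evenOdd
    (0 : QuadraticForm (MvPolynomial (ZMod n) K) (ZMod n →₀ MvPolynomial (ZMod n) K))
    i).restrictScalars K

/-- Even elements are central in an exterior algebra. -/
theorem exterior_even_comm {P M : Type u} [CommRing P] [AddCommGroup M] [Module P M]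
    (x : ExteriorAlgebra P M) (hx : x ∈ CliffordAlgebra.evenOdd (0 : QuadraticForm P M) 0)
    (y : ExteriorAlgebra P M) : x * y = y * x := by
  have anti : ∀ m m' : M, ExteriorAlgebra.ι P m * ExteriorAlgebra.ι P m' =
      -(ExteriorAlgebra.ι P m' * ExteriorAlgebra.ι P m) := fun m m' =>
    eq_neg_of_add_eq_zero_left (ExteriorAlgebra.ι_add_mul_swap m m')
  have base : ∀ (m m' : M) (y : ExteriorAlgebra P M),
      ExteriorAlgebra.ι P m * ExteriorAlgebra.ι P m' * y =
      y * (ExteriorAlgebra.ι P m * ExteriorAlgebra.ι P m') := by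
    intro m m' y
    induction y using ExteriorAlgebra.induction with
    | algebraMap r => exact (Algebra.commutes r _).symm
    | ι z =>
      rw [mul_assoc, anti m' z, mul_neg, ← mul_assoc, anti m z, neg_mul, neg_neg, mul_assoc]
    | mul a b ha hb => rw [← mul_assoc, ha, mul_assoc, hb, mul_assoc]
    | add a b ha hb => rw [mul_add, add_mul, ha, hb]
  induction x, hx using CliffordAlgebra.even_induction with
  | algebraMap r => exact Algebra.commutes r y
  | add _ _ hx hy h h' => rw [add_mul, mul_add, h, h']
  | ι_mul_ι_mul m m' x hx h =>
    rw [mul_assoc, h, ← mul_assoc]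
    exact (congrArg (· * x) (base m m' y)).trans (mul_assoc _ _ _)

/-- Odd elements of an exterior algebra anticommute. -/
theorem exterior_odd_anticomm {P M : Type u} [CommRing P] [AddCommGroup M] [Module P M]
    (x : ExteriorAlgebra P M) (hx : x ∈ CliffordAlgebra.evenOdd (0 : QuadraticForm P M) 1)
    (y : ExteriorAlgebra P M) (hy : y ∈ CliffordAlgebra.evenOdd (0 : QuadraticForm P M) 1) :
    x * y = -(y * x) := by
  have anti : ∀ m m' : M, ExteriorAlgebra.ι P m * ExteriorAlgebra.ι P m' =
      -(ExteriorAlgebra.ι P m' * ExteriorAlgebra.ι P m) := fun m m' =>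
    eq_neg_of_add_eq_zero_left (ExteriorAlgebra.ι_add_mul_swap m m')
  have pair : ∀ (m m' : M) (y : ExteriorAlgebra P M),
      CliffordAlgebra.ι (0 : QuadraticForm P M) m * CliffordAlgebra.ι 0 m' * y =
      y * (CliffordAlgebra.ι (0 : QuadraticForm P M) m * CliffordAlgebra.ι 0 m') := fun m m' y =>
    exterior_even_comm _ (CliffordAlgebra.ι_mul_ι_mem_evenOdd_zero _ m m') y
  have base : ∀ m : M, CliffordAlgebra.ι (0 : QuadraticForm P M) m * y =
      -(y * CliffordAlgebra.ι (0 : QuadraticForm P M) m) := by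
    intro m
    induction y, hy using CliffordAlgebra.odd_induction with
    | ι v => exact anti m v
    | add _ _ hx hy h h' => rw [mul_add, add_mul, h, h', neg_add]
    | ι_mul_ι_mul m₁ m₂ z hz h =>
      rw [← mul_assoc, ← pair m₁ m₂, mul_assoc, h, mul_neg, mul_assoc (_ * _) z]
  induction x, hx using CliffordAlgebra.odd_induction with
  | ι v => exact base v
  | add _ _ hx hy h h' => rw [mul_add, add_mul, h, h', neg_add]
  | ι_mul_ι_mul m₁ m₂ z hz h =>
    rw [mul_assoc, h, mul_neg, ← mul_assoc, pair m₁ m₂ y, mul_assoc]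

/-- Odd elements of an exterior algebra have square zero. -/
theorem exterior_odd_sq {P M : Type u} [CommRing P] [AddCommGroup M] [Module P M]
    (x : ExteriorAlgebra P M) (hx : x ∈ CliffordAlgebra.evenOdd (0 : QuadraticForm P M) 1) :
    x * x = 0 := by
  induction x, hx using CliffordAlgebra.odd_induction with
  | ι v => exact ExteriorAlgebra.ι_sq_zero v
  | add x y hx hy h h' =>
    rw [mul_add, add_mul, add_mul, h, h', exterior_odd_anticomm x hx y hy]
    simp
  | ι_mul_ι_mul m₁ m₂ z hz h =>
    have e := exterior_even_comm _
      (CliffordAlgebra.ι_mul_ι_mem_evenOdd_zero (0 : QuadraticForm P M) m₁ m₂) z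
    rw [mul_assoc, ← mul_assoc z, ← e, mul_assoc _ z z, h, mul_zero, mul_zero]

instance potentialSupercommutative (K : Type u) [Field K] (n : ℕ) :
    IsSupercommutative (potentialGrading K n) where
  even_comm := fun x hx y => exterior_even_comm x hx y
  odd_anticomm := fun x hx y hy => exterior_odd_anticomm x hx y hy
  odd_sq := fun x hx => exterior_odd_sq x hx

/-! ## Supersymmetric Hill equations -/

/-- The potential `U_i = β_i + ξ a_i` has even `a_i`, odd `β_i`, and satisfies the periodicity
conditions `a_{i+n} = a_i`, `β_{i+n} = -β_i`. -/
def IsPotential {K : Type u} [Field K] {R : Type v} [Ring R] [Algebra K R]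
    (𝓡 : ZMod 2 → Submodule K R) (n : ℕ) (a β : ℤ → R) : Prop :=
  ∀ i : ℤ, a i ∈ 𝓡 0 ∧ β i ∈ 𝓡 1 ∧ a (i + n) = a i ∧ β (i + n) = -β i

/-- The sequence `V_i + ξ W_i` is a solution of the supersymmetric discrete Sturm–Liouville
equation with potential `U_i = β_i + ξ a_i`. -/
def IsSolution {R : Type v} [Ring R] (a β V W : ℤ → R) : Prop :=
  ∀ i : ℤ, V i = a i * V (i - 1) - V (i - 2) - β i * W (i - 1) ∧
    W i = W (i - 1) + β i * V (i - 1)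

/-- The equation with potential `(a, β)` is a supersymmetric Hill equation: all its solutions
satisfy `V_{i+n} = -V_i` and `W_{i+n} = W_i`. -/
def IsHillEquation {K : Type u} [Field K] {R : Type v} [Ring R] [Algebra K R]
    (𝓡 : ZMod 2 → Submodule K R) (n : ℕ) (a β : ℤ → R) : Prop :=
  IsPotential 𝓡 n a β ∧
    ∀ V W : ℤ → R, IsSolution a β V W → ∀ i : ℤ, V (i + n) = -V i ∧ W (i + n) = W i

/-- The matrix taking `(V_{i-2}, V_{i-1}, W_{i-1})` to `(V_{i-1}, V_i, W_i)` for a solution. -/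
def stepMatrix {R : Type v} [Ring R] (a β : R) : Matrix (Fin 3) (Fin 3) R :=
  !![0, 1, 0;
     -1, a, -β;
     0, β, 1]

/-- The product `A_{i+k-1} ⋯ A_{i+1} A_i`; the monodromy matrix `M_i` is the case `k = n`. -/
def monodromy {R : Type v} [Ring R] (a β : ℤ → R) (i : ℤ) : ℕ → Matrix (Fin 3) (Fin 3) R
  | 0 => 1
  | k + 1 => stepMatrix (a (i + k)) (β (i + k)) * monodromy a β i k

/-- The matrix `diag(-1, -1, 1)`. -/
def hillMonodromy (R : Type v) [Ring R] : Matrix (Fin 3) (Fin 3) R :=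
  Matrix.diagonal ![-1, -1, 1]

/-! ## The supervariety of supersymmetric Hill equations -/

/-- The universal even coefficients `a_i ∈ K[a₁, …, aₙ | β₁, …, βₙ]`, with `a_{i+n} = a_i`. -/
def universalA (K : Type u) [Field K] (n : ℕ) (i : ℤ) : PotentialAlgebra K n :=
  algebraMap (MvPolynomial (ZMod n) K) _ (MvPolynomial.X (i : ZMod n))

/-- The universal odd coefficients `β_i ∈ K[a₁, …, aₙ | β₁, …, βₙ]`: the odd variables for
`0 ≤ i < n`, extended to all integers by `β_{i+n} = -β_i`. -/
def universalB (K : Type u) [Field K] (n : ℕ) (i : ℤ) : PotentialAlgebra K n :=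
  (Int.negOnePow (i / n) : ℤ) •
    ExteriorAlgebra.ι (MvPolynomial (ZMod n) K) (Finsupp.single (i : ZMod n) 1)

/-- The nine polynomial equations `M_1 = diag(-1, -1, 1)`, for the universal potential. -/
def hillEquations (K : Type u) [Field K] (n : ℕ) : Set (PotentialAlgebra K n) :=
  Set.range fun p : Fin 3 × Fin 3 =>
    monodromy (universalA K n) (universalB K n) 1 n p.1 p.2 - hillMonodromy _ p.1 p.2

/-- The superalgebra of regular functions on the supervariety `E_n` cut out from the space of
potentials by the condition `M_1 = diag(-1, -1, 1)`. (The entries of `M_1` are homogeneous, so this is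
the quotient by the two-sided ideal generated by the nine equations.) -/
abbrev HillAlgebra (K : Type u) [Field K] (n : ℕ) : Type u :=
  SuperQuot (potentialGrading K n) (hillEquations K n)

/-- The even and odd parts of the superalgebra of regular functions on `E_n`. -/
abbrev hillGrading (K : Type u) [Field K] (n : ℕ) (i : ZMod 2) :
    Submodule K (HillAlgebra K n) :=
  superQuotGrading (potentialGrading K n) (hillEquations K n) i

/-- The map from regular functions on the space of potentials to regular functions on `E_n`. -/
abbrev hillMk (K : Type u) [Field K] (n : ℕ) : PotentialAlgebra K n →ₐ[K] HillAlgebra K n :=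
  superQuotMk (potentialGrading K n) (hillEquations K n)

end

noncomputable section

/-! ## Krull dimension and transcendence degree -/

/-! A solution is determined by its state `(V_{i-2}, V_{i-1}, W_{i-1})`, every state occurs because
the step matrices are invertible, and `M_i` carries the state at `i` to the state at `i + n`. So the
Hill condition is an equation on one monodromy matrix; the base point is irrelevant because
consecutive monodromies are related by a step matrix that intertwines `diag(-1, -1, 1)` with the
sign change of `β` (`forall_solution_iff`, `isHillEquation_iff`). Representability of potentials is
the universal property of the exterior algebra, and Hill equations are cut out by the entries of one
matrix equation.

Even dimension, upper bound: Krull dimension sees only points in fields, where odd elements vanish.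
What remains is an `SL₂` product of `n` steps equal to `-1`, and its coefficients lie in a field
generated by `n - 3` of its elements (`exists_adjoin_of_slMonodromy`): generically the first `n - 3`
steps determine the last three.

Odd dimension, upper bound: comparing the odd entries of the first `n - 3` steps with those of the
inverse of the last three shows that a coefficient `a_j` multiplies every `β_i` into the even span
of `n - 2` odd elements (`exists_odd_family_of_monodromy`). A power of each `a_j` therefore
annihilates any product of more than `n - 2` odd elements, so the quotient by the annihilator of
such a product has dimension at most `0`; for `n = 3` all `a_j` equal `1` and the product vanishes.

Lower bounds, both at once: over the exterior algebra on `n - 2` generators of a rational function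
field in `n - 3` variables, the first `n - 3` pairs `(a, β)` and one further `β` are taken generic.
The partial product lies in `OSp(1|2)`, and since its middle entry is invertible the last three
steps can be solved for (`IsOSp.exists_three_steps`). At this point the product of the chosen odd
functions is the nonzero top form, so elements annihilating it have zero scalar part and the `n - 3`
variables stay independent modulo the annihilator (`le_ringKrullDim_quotient_evenAnnihilator`). -/

theorem ringKrullDim_eq_of_isIntegral_of_injective {A B : Type*} [CommRing A] [CommRing B]
    [Algebra A B] [Algebra.IsIntegral A B] (h : Function.Injective (algebraMap A B)) :
    ringKrullDim B = ringKrullDim A := by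
  apply le_antisymm
  -- Incomparability: contraction of primes along an integral extension is strictly monotone.
  · refine Order.krullDim_le_of_strictMono (PrimeSpectrum.comap (algebraMap A B)) ?_
    intro p q hpq
    exact Ideal.IsIntegral.comap_lt_comap (R := A) (I := p.asIdeal) (J := q.asIdeal) hpq
  · refine iSup_le fun l => ?_
    -- Lying over for the bottom prime of the chain; going up then lifts the rest.
    obtain ⟨Q, hQ, hQl⟩ := Ideal.exists_ideal_over_prime_of_isIntegral (S := B)
      l.head.asIdeal ⊥ (by
        rw [← RingHom.ker_eq_comap_bot, (RingHom.injective_iff_ker_eq_bot _).1 h]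
        exact bot_le)
    have := hQl.1
    have : Q.LiesOver l.head.asIdeal := ⟨hQl.2.symm⟩
    obtain ⟨L, hL, -⟩ := Ideal.exists_ltSeries_of_hasGoingUp l Q
    rw [← hL]
    exact Order.LTSeries.length_le_krullDim L

/-- The dimension of an affine domain is its transcendence degree. -/
theorem exists_ringKrullDim_eq_and_trdeg_eq (K : Type u) [Field K] (D : Type u) [CommRing D]
    [IsDomain D] [Algebra K D] [Algebra.FiniteType K D] :
    ∃ s : ℕ, ringKrullDim D = s ∧ Algebra.trdeg K D = s := by
  obtain ⟨s, g, hg, hint⟩ := exists_integral_inj_algHom_of_fg K D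
  algebraize [g.toRingHom]
  have : Algebra.IsIntegral (MvPolynomial (Fin s) K) D := ⟨hint⟩
  have : IsScalarTower K (MvPolynomial (Fin s) K) D :=
    IsScalarTower.of_algebraMap_eq fun x => (g.commutes x).symm
  have : FaithfulSMul (MvPolynomial (Fin s) K) D :=
    (faithfulSMul_iff_algebraMap_injective _ _).2 hg
  refine ⟨s, ?_, ?_⟩
  · rw [ringKrullDim_eq_of_isIntegral_of_injective (A := MvPolynomial (Fin s) K) hg,
      MvPolynomial.ringKrullDim_of_isNoetherianRing, ringKrullDim_eq_zero_of_field]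
    simp
  · have h := trdeg_add_eq K (MvPolynomial (Fin s) K) (A := D)
    have h0 : Algebra.trdeg (MvPolynomial (Fin s) K) D = 0 := by
      exact trdeg_eq_zero
    rw [← h, h0, MvPolynomial.trdeg_of_isDomain]
    simp

/-- The generated subalgebra is a quotient of a polynomial ring in `s.card` variables, and passing
to its fraction field does not change the transcendence degree. -/
theorem trdeg_adjoin_le {K F : Type u} [Field K] [Field F] [Algebra K F] (s : Finset F) :
    Algebra.trdeg K (IntermediateField.adjoin K (s : Set F)) ≤ s.card := by
  open scoped IntermediateField.algebraAdjoinAdjoin in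
  have h1 : Algebra.trdeg K (Algebra.adjoin K (s : Set F)) =
      Algebra.trdeg K (IntermediateField.adjoin K (s : Set F)) := by
    rw [← trdeg_add_eq K (Algebra.adjoin K (s : Set F))
      (A := IntermediateField.adjoin K (s : Set F)),
      trdeg_eq_zero (R := Algebra.adjoin K (s : Set F)), add_zero]
  rw [← h1, Algebra.adjoin_eq_range]
  have h2 := trdeg_le_of_surjective (MvPolynomial.aeval (R := K) fun x : (s : Set F) => (x : F)).rangeRestrict
    (AlgHom.rangeRestrict_surjective _)
  rw [MvPolynomial.trdeg_of_isDomain] at h2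
  simpa using h2

/-- The dimension of `D` is its transcendence degree, and `q` embeds `D` into a field generated by
`s`. -/
theorem ringKrullDim_le_of_adjoin {K D F : Type u} [Field K] [CommRing D] [IsDomain D]
    [Algebra K D] [Field F] [Algebra K F] {σ : Type*} [Finite σ]
    (h : MvPolynomial σ K →ₐ[K] D) (hh : Function.Surjective h) (q : D →ₐ[K] F)
    (hq : Function.Injective q) (s : Finset F)
    (hs : ∀ i, q (h (MvPolynomial.X i)) ∈ IntermediateField.adjoin K (s : Set F)) :
    ringKrullDim D ≤ s.card := by
  have : Algebra.FiniteType K D := Algebra.FiniteType.of_surjective h hh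
  obtain ⟨r, hr, ht⟩ := exists_ringKrullDim_eq_and_trdeg_eq K D
  have hmem : ∀ x, q x ∈ IntermediateField.adjoin K (s : Set F) := by
    intro x
    obtain ⟨p, rfl⟩ := hh x
    induction p using MvPolynomial.induction_on with
    | C c =>
      have : q (h (MvPolynomial.C c)) = algebraMap K F c := by
        rw [← MvPolynomial.algebraMap_eq, AlgHom.commutes, AlgHom.commutes]
      rw [this]
      exact IntermediateField.algebraMap_mem _ _
    | add a b ha hb => rw [map_add, map_add]; exact add_mem ha hb
    | mul_X a i ha => rw [map_mul, map_mul]; exact mul_mem ha (hs i)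
  have hle := trdeg_le_of_injective
    (q.codRestrict (IntermediateField.adjoin K (s : Set F)).toSubalgebra hmem)
    (fun x y hxy => hq (congrArg Subtype.val hxy))
  have hle' := hle.trans (trdeg_adjoin_le s)
  rw [ht] at hle'
  rw [hr]
  exact_mod_cast hle'

/-- A chain of primes starting at `Q` already lives in the spectrum of `T ⧸ Q`. -/
theorem ringKrullDim_le_of_forall_prime {T : Type*} [CommRing T] (d : ℕ)
    (h : ∀ Q : Ideal T, Q.IsPrime → ringKrullDim (T ⧸ Q) ≤ d) : ringKrullDim T ≤ d := by
  refine iSup_le fun l => ?_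
  have hl := h l.head.asIdeal l.head.isPrime
  rw [ringKrullDim_quotient] at hl
  refine le_trans ?_ hl
  let L : LTSeries (PrimeSpectrum.zeroLocus (R := T) l.head.asIdeal) :=
    { length := l.length
      toFun := fun i => ⟨l i, LTSeries.head_le l i⟩
      step := fun i => l.step i }
  exact Order.LTSeries.length_le_krullDim L

/-- Upper bound for the dimension of an algebra that is, up to nilpotents, generated by the
images of finitely many variables. -/
theorem ringKrullDim_le_of_forall_field {K T : Type u} [Field K] [CommRing T] [Algebra K T]
    {σ : Type*} [Finite σ] (f : MvPolynomial σ K →ₐ[K] T)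
    (hf : ∀ t, ∃ p, IsNilpotent (t - f p)) (d : ℕ)
    (hd : ∀ (F : Type u) [Field F] [Algebra K F] (g : T →ₐ[K] F), ∃ s : Finset F, s.card ≤ d ∧
      ∀ i, g (f (MvPolynomial.X i)) ∈ IntermediateField.adjoin K (s : Set F)) :
    ringKrullDim T ≤ d := by
  refine ringKrullDim_le_of_forall_prime d fun Q hQ => ?_
  -- The test field is the residue field at `Q`. Nilpotents die in `T ⧸ Q`, so the variables
  -- generate that quotient.
  let F := FractionRing (T ⧸ Q)
  let q : (T ⧸ Q) →ₐ[K] F := IsScalarTower.toAlgHom K (T ⧸ Q) F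
  obtain ⟨s, hs, hs'⟩ := hd F (q.comp (Ideal.Quotient.mkₐ K Q))
  refine (ringKrullDim_le_of_adjoin ((Ideal.Quotient.mkₐ K Q).comp f) ?_ q
    (IsFractionRing.injective (T ⧸ Q) F) s hs').trans (by exact_mod_cast hs)
  intro x
  obtain ⟨t, rfl⟩ := Ideal.Quotient.mk_surjective x
  obtain ⟨p, hp⟩ := hf t
  refine ⟨p, ?_⟩
  have := hp.map (Ideal.Quotient.mk Q)
  exact (sub_eq_zero.1 (by simpa using this.eq_zero)).symm

/-- Lower bound for the dimension of an algebra that is, up to nilpotents, generated by the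
images of finitely many variables. -/
theorem le_ringKrullDim_of_algebraicIndependent {K T F : Type u} [Field K] [CommRing T]
    [Algebra K T] {σ : Type*} [Finite σ] (f : MvPolynomial σ K →ₐ[K] T)
    (hf : ∀ t, ∃ p, IsNilpotent (t - f p)) [Field F] [Algebra K F] (g : T →ₐ[K] F)
    {d : ℕ} (x : Fin d → T) (hx : AlgebraicIndependent K fun i => g (x i)) :
    (d : WithBot ℕ∞) ≤ ringKrullDim T := by
  have hsurj : Function.Surjective (g.rangeRestrict.comp f) := by
    rintro ⟨_, t, rfl⟩
    obtain ⟨p, hp⟩ := hf t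
    refine ⟨p, Subtype.ext ?_⟩
    have := hp.map g
    exact (sub_eq_zero.1 (by simpa using this.eq_zero)).symm
  have : Algebra.FiniteType K g.range := Algebra.FiniteType.of_surjective _ hsurj
  obtain ⟨r, hr, ht⟩ := exists_ringKrullDim_eq_and_trdeg_eq K g.range
  have hx' : AlgebraicIndependent K fun i => g.rangeRestrict (x i) :=
    AlgebraicIndependent.of_comp g.range.val hx
  have h1 := hx'.lift_cardinalMk_le_trdeg
  rw [ht] at h1
  have h2 : d ≤ r := by simpa using h1
  refine le_trans ?_ (ringKrullDim_le_of_surjective g.rangeRestrict.toRingHom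
    g.rangeRestrict_surjective)
  rw [hr]
  exact_mod_cast h2

/-! ## The commutative case: dimension of the variety of monodromy `±1` -/

/-- The matrix of one step of the discrete Sturm–Liouville equation `V_i = a_i V_{i-1} - V_{i-2}`. -/
def slStep {F : Type*} [Ring F] (a : F) : Matrix (Fin 2) (Fin 2) F := !![0, 1; -1, a]

/-- The product of the first `k` step matrices. -/
def slMonodromy {F : Type*} [Ring F] (a : ℕ → F) : ℕ → Matrix (Fin 2) (Fin 2) F
  | 0 => 1
  | k + 1 => slStep (a k) * slMonodromy a k

theorem slMonodromy_congr {F : Type*} [Ring F] {a b : ℕ → F} {k : ℕ} (h : ∀ i < k, a i = b i) :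
    slMonodromy a k = slMonodromy b k := by
  induction k with
  | zero => rfl
  | succ k ih =>
    rw [slMonodromy, slMonodromy, h k k.lt_succ_self, ih fun i hi => h i (hi.trans k.lt_succ_self)]

theorem slMonodromy_mem {K F : Type*} [Field K] [Field F] [Algebra K F]
    (E : IntermediateField K F) {a : ℕ → F} {k : ℕ} (h : ∀ i < k, a i ∈ E) (p q : Fin 2) :
    slMonodromy a k p q ∈ E := by
  induction k generalizing p q with
  | zero =>
    rw [slMonodromy, Matrix.one_apply]
    split_ifs
    exacts [one_mem _, zero_mem _]
  | succ k ih =>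
    rw [slMonodromy, Matrix.mul_apply]
    refine sum_mem fun j _ => mul_mem ?_ (ih (fun i hi => h i (hi.trans k.lt_succ_self)) j q)
    have := h k k.lt_succ_self
    fin_cases p <;> fin_cases j <;> simp [slStep, this]

theorem slStep_mul_three_inv {F : Type*} [CommRing F] (a b c : F) :
    !![c * (a * b - 1) - a, 1 - a * b; b * c - 1, -b] *
      (slStep c * (slStep b * slStep a)) = 1 := by
  ext i j
  fin_cases i <;> fin_cases j <;> simp [slStep] <;> ring

theorem slStep_mul_slStep_zero_mul {F : Type*} [CommRing F] (a c : F) :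
    slStep c * (slStep 0 * slStep a) = -slStep (a + c) := by
  ext i j
  fin_cases i <;> fin_cases j <;> simp [slStep]
  ring

/-- If the product of `m` step matrices is `±1`, the coefficients lie in a field generated by
`m - 3` elements. -/
theorem exists_adjoin_of_slMonodromy {K F : Type*} [Field K] [Field F] [Algebra K F]
    (m : ℕ) (hm : 2 ≤ m) (a : ℕ → F) (ε : F) (hε : ε * ε = 1)
    (h : slMonodromy a m = Matrix.diagonal fun _ => ε) :
    ∃ s : Finset F, s.card ≤ m - 3 ∧ ∀ i < m, a i ∈ IntermediateField.adjoin K (s : Set F) := by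
  classical
  induction m using Nat.strong_induction_on generalizing a ε with
  | _ m ih =>
  obtain rfl | ⟨k, rfl⟩ : m = 2 ∨ ∃ k, m = k + 3 := by
    rcases hm.eq_or_lt with h | h
    · exact Or.inl h.symm
    · exact Or.inr ⟨m - 3, by omega⟩
  · have h01 := congrFun (congrFun h 0) 1
    have h10 := congrFun (congrFun h 1) 0
    simp [slMonodromy, slStep] at h01 h10
    refine ⟨∅, by simp, fun i hi => ?_⟩
    interval_cases i
    · rw [h01]; exact zero_mem _
    · rw [h10]; exact zero_mem _
  -- The first `k` steps are the inverse of the last three, times the scalar `ε`.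
  · have hT : slMonodromy a k =
        !![a (k + 2) * (a k * a (k + 1) - 1) - a k, 1 - a k * a (k + 1);
          a (k + 1) * a (k + 2) - 1, -a (k + 1)] * Matrix.diagonal fun _ => ε := by
      rw [← h]
      simp only [slMonodromy]
      rw [← mul_assoc (slStep (a (k + 1))), ← mul_assoc (slStep (a (k + 2))), ← mul_assoc,
        slStep_mul_three_inv, one_mul]
    -- If the middle of the last three coefficients vanishes, these steps collapse to minus a single
    -- step with coefficient `a k + a (k + 2)`, so the length drops by two and `ε` changes sign.
    -- Otherwise the entries of the first `k` steps give all three coefficients.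
    by_cases hb : a (k + 1) = 0
    · have hk : k ≠ 0 := by
        rintro rfl
        have := congrFun (congrFun hT 1) 1
        simp [slMonodromy] at this hb
        simp [hb] at this
      set a' : ℕ → F := Function.update a k (a k + a (k + 2)) with ha'
      have h' : slMonodromy a' (k + 1) = Matrix.diagonal fun _ => -ε := by
        rw [slMonodromy, slMonodromy_congr (b := a) fun i hi => by simp [ha', hi.ne]]
        have h2 : slStep (a (k + 2)) * (slStep (a (k + 1)) * slStep (a k)) * slMonodromy a k =
            Matrix.diagonal fun _ => ε := by
          rw [← h, mul_assoc, mul_assoc]; rfl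
        rw [hb, slStep_mul_slStep_zero_mul, neg_mul, neg_eq_iff_eq_neg] at h2
        rw [ha', Function.update_self, h2, Matrix.diagonal_neg]
      obtain ⟨s, hs, hmem⟩ := ih (k + 1) (by omega) (by omega) a' (-ε) (by simpa using hε) h'
      -- The collapse knows only the sum, so `a k` is added as a generator. The count `(k + 1 - 3) +
      -- 1 ≤ k` with truncated subtraction needs `k ≠ 0`.
      refine ⟨insert (a k) s, (Finset.card_insert_le _ _).trans (by omega), fun i hi => ?_⟩
      have hle : IntermediateField.adjoin K (s : Set F) ≤
          IntermediateField.adjoin K ((insert (a k) s : Finset F) : Set F) :=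
        IntermediateField.adjoin.mono _ _ _ (by simp)
      have hak : a k ∈ IntermediateField.adjoin K ((insert (a k) s : Finset F) : Set F) :=
        IntermediateField.subset_adjoin _ _ (by simp)
      rcases lt_trichotomy i k with hik | rfl | hik
      · have := hle (hmem i (by omega))
        rwa [ha', Function.update_of_ne hik.ne] at this
      · exact hak
      · obtain rfl | rfl : i = k + 1 ∨ i = k + 2 := by omega
        · rw [hb]; exact zero_mem _
        · have := hle (hmem k (by omega))
          rw [ha', Function.update_self] at this
          simpa using sub_mem this hak
    · refine ⟨(Finset.range k).image a, Finset.card_image_le.trans (by simp), ?_⟩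
      set E := IntermediateField.adjoin K (((Finset.range k).image a : Finset F) : Set F)
      have hlow : ∀ i < k, a i ∈ E := fun i hi =>
        IntermediateField.subset_adjoin _ _
          (Finset.mem_coe.2 (Finset.mem_image_of_mem a (Finset.mem_range.2 hi)))
      have hε' : ε ∈ E := by
        rcases mul_self_eq_one_iff.1 hε with rfl | rfl
        exacts [one_mem _, neg_mem (one_mem _)]
      have hmem := fun p q => slMonodromy_mem E hlow p q
      have h11 := congrFun (congrFun hT 1) 1
      have h01 := congrFun (congrFun hT 0) 1
      have h10 := congrFun (congrFun hT 1) 0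
      simp [Matrix.mul_diagonal] at h11 h01 h10
      have hbE : a (k + 1) ∈ E := by
        have : a (k + 1) = -(slMonodromy a k 1 1 * ε) := by
          rw [h11]; linear_combination -a (k + 1) * hε
        rw [this]; exact neg_mem (mul_mem (hmem _ _) hε')
      have haE : a k ∈ E := by
        have : a k = (1 - slMonodromy a k 0 1 * ε) / a (k + 1) := by
          rw [h01, eq_div_iff hb]; linear_combination (a k * a (k + 1) - 1) * -hε
        rw [this]; exact div_mem (sub_mem (one_mem _) (mul_mem (hmem _ _) hε')) hbE
      have hcE : a (k + 2) ∈ E := by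
        have : a (k + 2) = (1 + slMonodromy a k 1 0 * ε) / a (k + 1) := by
          rw [h10, eq_div_iff hb]; linear_combination (a (k + 1) * a (k + 2) - 1) * -hε
        rw [this]; exact div_mem (add_mem (one_mem _) (mul_mem (hmem _ _) hε')) hbE
      intro i hi
      rcases lt_or_ge i k with hik | hik
      · exact hlow i hik
      · obtain rfl | rfl | rfl : i = k ∨ i = k + 1 ∨ i = k + 2 := by omega
        exacts [haE, hbE, hcE]

/-! ## Even parts of supercommutative algebras -/

section EvenPart

variable {K : Type u} [Field K] {R : Type v} [Ring R] [Algebra K R]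
  (𝓡 : ZMod 2 → Submodule K R) [GradedAlgebra 𝓡]

theorem zmod_two_decompose_add (x : R) :
    (decompose 𝓡 x 0 : R) + (decompose 𝓡 x 1 : R) = x := by
  classical
  conv_rhs => rw [← DirectSum.sum_support_decompose 𝓡 x]
  rw [Finset.sum_subset (Finset.subset_univ _)]
  · exact (Fin.sum_univ_two fun i : Fin 2 => ((decompose 𝓡 x (i : ZMod 2) : 𝓡 i) : R)).symm
  · intro i _ hi
    simpa using hi

theorem even_mul_even {x y : R} (hx : x ∈ 𝓡 0) (hy : y ∈ 𝓡 0) : x * y ∈ 𝓡 0 := by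
  simpa using SetLike.GradedMul.mul_mem (A := 𝓡) hx hy

theorem even_mul_odd {x y : R} (hx : x ∈ 𝓡 0) (hy : y ∈ 𝓡 1) : x * y ∈ 𝓡 1 := by
  simpa using SetLike.GradedMul.mul_mem (A := 𝓡) hx hy

theorem odd_mul_even {x y : R} (hx : x ∈ 𝓡 1) (hy : y ∈ 𝓡 0) : x * y ∈ 𝓡 1 := by
  simpa using SetLike.GradedMul.mul_mem (A := 𝓡) hx hy

theorem odd_mul_odd {x y : R} (hx : x ∈ 𝓡 1) (hy : y ∈ 𝓡 1) : x * y ∈ 𝓡 0 :=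
  SetLike.GradedMul.mul_mem (A := 𝓡) hx hy

theorem even_one : (1 : R) ∈ 𝓡 0 := SetLike.GradedOne.one_mem

/-- The inclusion of the even part. -/
def evenSubtype : 𝓡 0 →ₐ[K] R where
  toFun := Subtype.val
  map_one' := rfl
  map_mul' _ _ := rfl
  map_zero' := rfl
  map_add' _ _ := rfl
  commutes' _ := rfl

theorem isNilpotent_even_iff (x : 𝓡 0) : IsNilpotent x ↔ IsNilpotent (x : R) :=
  (IsNilpotent.map_iff (f := evenSubtype 𝓡) Subtype.val_injective).symm

theorem even_odd_unique {x y x' y' : R} (hx : x ∈ 𝓡 0) (hx' : x' ∈ 𝓡 0) (hy : y ∈ 𝓡 1)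
    (hy' : y' ∈ 𝓡 1) (h : x + y = x' + y') : x = x' ∧ y = y' := by
  have h0 : ((decompose 𝓡 (x + y) 0 : 𝓡 0) : R) = decompose 𝓡 (x' + y') 0 := by rw [h]
  have h01 : (1 : ZMod 2) ≠ 0 := by decide
  rw [decompose_add, decompose_add, DirectSum.add_apply, DirectSum.add_apply,
    decompose_of_mem 𝓡 hx, decompose_of_mem 𝓡 hx', decompose_of_mem 𝓡 hy,
    decompose_of_mem 𝓡 hy', DirectSum.of_eq_same, DirectSum.of_eq_same,
    DirectSum.of_eq_of_ne _ _ _ h01.symm, DirectSum.of_eq_of_ne _ _ _ h01.symm, add_zero, add_zero] at h0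
  refine ⟨h0, ?_⟩
  have h0' : x = x' := h0
  rw [h0'] at h
  exact add_left_cancel h

variable [IsSupercommutative 𝓡]

/-- Homomorphisms from the even part to a field extend to the whole algebra, by zero on odd
elements. -/
def evenExtend {F : Type*} [Field F] [Algebra K F] (g : 𝓡 0 →ₐ[K] F) : R →ₐ[K] F where
  toFun x := g (decompose 𝓡 x 0)
  map_one' := by
    rw [decompose_of_mem 𝓡 (even_one 𝓡), DirectSum.of_eq_same]
    exact map_one g
  map_mul' x y := by
    have hx := zmod_two_decompose_add 𝓡 x
    have hy := zmod_two_decompose_add 𝓡 y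
    set x0 := decompose 𝓡 x 0
    set x1 := decompose 𝓡 x 1
    set y0 := decompose 𝓡 y 0
    set y1 := decompose 𝓡 y 1
    let w : 𝓡 0 := ⟨(x1 : R) * y1, odd_mul_odd 𝓡 x1.2 y1.2⟩
    -- A product of two odd elements squares to zero, hence is invisible in a field; this is what
    -- makes extension by zero multiplicative.
    have hw : g w = 0 := by
      refine IsNilpotent.eq_zero (IsNilpotent.map (r := w) ⟨2, Subtype.ext ?_⟩ g)
      change ((x1 : R) * y1) ^ 2 = 0
      rw [pow_two, mul_assoc, ← mul_assoc (y1 : R),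
        IsSupercommutative.odd_anticomm (𝓡 := 𝓡) y1 y1.2 x1 x1.2, neg_mul, mul_assoc (x1 : R),
        IsSupercommutative.odd_sq (𝓡 := 𝓡) y1 y1.2]
      simp
    have key : decompose 𝓡 (x * y) 0 = x0 * y0 + w := by
      have hxy : x * y = ((x0 * y0 + w : 𝓡 0) : R) + ((x0 : R) * y1 + x1 * y0) := by
        change _ = (x0 : R) * y0 + (x1 : R) * y1 + _
        rw [← hx, ← hy]
        noncomm_ring
      have := even_odd_unique 𝓡 (decompose 𝓡 (x * y) 0).2 (x0 * y0 + w : 𝓡 0).2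
        (decompose 𝓡 (x * y) 1).2
        (add_mem (even_mul_odd 𝓡 x0.2 y1.2) (odd_mul_even 𝓡 x1.2 y0.2))
        ((zmod_two_decompose_add 𝓡 (x * y)).trans hxy)
      exact Subtype.ext this.1
    rw [key, map_add, hw, add_zero, map_mul]
  map_zero' := by
    rw [decompose_zero, DirectSum.zero_apply, map_zero]
  map_add' x y := by
    rw [decompose_add, DirectSum.add_apply, map_add]
  commutes' c := by
    have : algebraMap K R c ∈ 𝓡 0 := SetLike.algebraMap_mem_graded 𝓡 c
    rw [decompose_of_mem 𝓡 this, DirectSum.of_eq_same]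
    exact g.commutes c

theorem evenExtend_even {F : Type*} [Field F] [Algebra K F] (g : 𝓡 0 →ₐ[K] F) (x : 𝓡 0) :
    evenExtend 𝓡 g x = g x := by
  change g (decompose 𝓡 (x : R) 0) = g x
  rw [decompose_coe, DirectSum.of_eq_same]

theorem evenExtend_odd {F : Type*} [Field F] [Algebra K F] (g : 𝓡 0 →ₐ[K] F) {x : R}
    (hx : x ∈ 𝓡 1) : evenExtend 𝓡 g x = 0 := by
  change g (decompose 𝓡 x 0) = 0
  rw [decompose_of_mem 𝓡 hx, DirectSum.of_eq_of_ne _ _ _ (by decide), map_zero]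

/-- A product of more than `k` odd elements in the span of `k` odd elements vanishes. -/
theorem prod_odd_eq_zero {ι : Type*} [Fintype ι] (θ : ι → R) (hθ : ∀ i, θ i ∈ 𝓡 1) {s : ℕ}
    (hs : Fintype.card ι < s) (y : Fin s → R) (c : Fin s → ι → 𝓡 0)
    (hy : ∀ j, y j = ∑ i, (c j i : R) * θ i) : (List.ofFn y).prod = 0 := by
  classical
  let : Algebra (𝓡 0) R := RingHom.toAlgebra' (evenSubtype 𝓡).toRingHom fun a x =>
    IsSupercommutative.even_comm (𝓡 := 𝓡) a a.2 x
  have hsmul : ∀ (a : 𝓡 0) (x : R), a • x = (a : R) * x := fun a x => Algebra.smul_def a x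
  let f : (ι → 𝓡 0) →ₗ[𝓡 0] R := Fintype.linearCombination (𝓡 0) θ
  have hf : ∀ v, f v = ∑ i, (v i : R) * θ i := fun v => by
    simp only [f, Fintype.linearCombination_apply, hsmul]
  have hf2 : ∀ v, f v * f v = 0 := fun v =>
    IsSupercommutative.odd_sq (𝓡 := 𝓡) _ (by
      rw [hf]; exact sum_mem fun i _ => even_mul_odd 𝓡 (v i).2 (hθ i))
  let Φ := ExteriorAlgebra.lift (𝓡 0) ⟨f, hf2⟩
  -- The product is an alternating form of degree `s` on a free module of rank below `s`. Such a
  -- form is zero, there being no injective choice of basis vectors.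
  have h0 : Φ.toLinearMap.compAlternatingMap (ExteriorAlgebra.ιMulti (𝓡 0) s) = 0 := by
    refine Module.Basis.ext_alternating (Pi.basisFun (𝓡 0) ι) fun v hv => ?_
    have := Fintype.card_le_of_injective v hv
    rw [Fintype.card_fin] at this
    omega
  have h1 := DFunLike.congr_fun h0 c
  simp only [LinearMap.compAlternatingMap_apply, ExteriorAlgebra.ιMulti_apply,
    AlgHom.toLinearMap_apply, map_list_prod, List.map_ofFn, AlternatingMap.zero_apply] at h1
  rw [← h1]
  congr 2
  funext j
  simp [Φ, hf, hy]

end EvenPart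

/-! ## Monodromy of a potential -/

section Monodromy

open Matrix

variable {R : Type v} [Ring R]

/-- The inverse of `stepMatrix a β`, when `β * β = 0`. -/
def stepInv (a β : R) : Matrix (Fin 3) (Fin 3) R :=
  !![a, -1, -β;
     1, 0, 0;
     -β, 0, 1]

theorem stepInv_mul {a β : R} (h : β * β = 0) : stepInv a β * stepMatrix a β = 1 := by
  ext i j
  fin_cases i <;> fin_cases j <;>
    simp [stepInv, stepMatrix, Matrix.mul_apply, Fin.sum_univ_three, h]

theorem mul_stepInv {a β : R} (h : β * β = 0) : stepMatrix a β * stepInv a β = 1 := by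
  ext i j
  fin_cases i <;> fin_cases j <;>
    simp [stepInv, stepMatrix, Matrix.mul_apply, Fin.sum_univ_three, h]

theorem monodromy_succ' (a β : ℤ → R) (i : ℤ) (k : ℕ) :
    monodromy a β i (k + 1) = monodromy a β (i + 1) k * stepMatrix (a i) (β i) := by
  induction k with
  | zero => simp [monodromy]
  | succ k ih =>
    rw [monodromy, ih, monodromy, mul_assoc]
    push_cast
    rw [add_right_comm i 1 (k : ℤ), add_assoc i]

theorem stepMatrix_neg_mul_hillMonodromy (a β : R) :
    stepMatrix a (-β) * hillMonodromy R = hillMonodromy R * stepMatrix a β := by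
  ext i j
  fin_cases i <;> fin_cases j <;>
    simp [stepMatrix, hillMonodromy, Matrix.mul_diagonal, Matrix.diagonal_mul]

variable {a β : ℤ → R} {n : ℕ}

/-- The product of `n + 1` steps, split at either end, gives `M_{i+1} A_i = A_{i+n} M_i`, where
`A_{i+n}` is `A_i` with `-β_i`. The matrix `diag(-1, -1, 1)` satisfies the same intertwining
relation, and the steps are invertible. -/
theorem monodromy_succ_eq_iff (hβ : ∀ i, β i * β i = 0)
    (hp : ∀ i : ℤ, a (i + n) = a i ∧ β (i + n) = -β i) (i : ℤ) :
    monodromy a β (i + 1) n = hillMonodromy R ↔ monodromy a β i n = hillMonodromy R := by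
  have h1 : monodromy a β (i + 1) n * stepMatrix (a i) (β i) =
      stepMatrix (a i) (-β i) * monodromy a β i n := by
    rw [← monodromy_succ', monodromy, (hp i).1, (hp i).2]
  constructor
  · intro h
    rw [h, ← stepMatrix_neg_mul_hillMonodromy] at h1
    have h2 := congrArg (stepInv (a i) (-β i) * ·) h1
    simp only [← mul_assoc, stepInv_mul (a := a i) (β := -β i) (by simp [hβ i]), one_mul] at h2
    exact h2.symm
  · intro h
    rw [h, stepMatrix_neg_mul_hillMonodromy] at h1
    have h2 := congrArg (· * stepInv (a i) (β i)) h1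
    simpa only [mul_assoc, mul_stepInv (hβ i), mul_one] using h2

theorem monodromy_eq_iff (hβ : ∀ i, β i * β i = 0)
    (hp : ∀ i : ℤ, a (i + n) = a i ∧ β (i + n) = -β i) (i j : ℤ) :
    monodromy a β i n = hillMonodromy R ↔ monodromy a β j n = hillMonodromy R := by
  have key : ∀ i : ℤ, monodromy a β i n = hillMonodromy R ↔
      monodromy a β 0 n = hillMonodromy R := by
    intro i
    induction i using Int.induction_on with
    | zero => rfl
    | succ i ih => rw [monodromy_succ_eq_iff hβ hp, ih]
    | pred i ih => rw [← ih, ← monodromy_succ_eq_iff hβ hp, sub_add_cancel]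
  rw [key i, key j]

/-- Two-sided recursion: iterate forwards above `i` and by the inverses below it. -/
theorem exists_int_orbit {X : Type*} (f : ℤ → X ≃ X) (i : ℤ) (x : X) :
    ∃ T : ℤ → X, T i = x ∧ ∀ m, T (m + 1) = f m (T m) := by
  let fw : ℕ → X := fun k => Nat.rec x (fun k y => f (i + k) y) k
  let bw : ℕ → X := fun k => Nat.rec x (fun k y => (f (i - k - 1)).symm y) k
  refine ⟨fun m => if i ≤ m then fw (m - i).toNat else bw (i - m).toNat, by simp [fw], fun m => ?_⟩
  rcases lt_trichotomy m (i - 1) with h | rfl | h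
  · obtain ⟨k, hk⟩ : ∃ k : ℕ, (i - m).toNat = k + 1 := ⟨(i - m).toNat - 1, by omega⟩
    have hk' : (i - (m + 1)).toNat = k := by omega
    have hm : m = i - k - 1 := by omega
    simp only [if_neg (show ¬ i ≤ m by omega), if_neg (show ¬ i ≤ m + 1 by omega), hk, hk']
    change bw k = f m ((f (i - k - 1)).symm (bw k))
    rw [← hm, Equiv.apply_symm_apply]
  · simp [fw, bw]
  · obtain ⟨k, hk⟩ : ∃ k : ℕ, (m - i).toNat = k := ⟨_, rfl⟩
    have hk' : (m + 1 - i).toNat = k + 1 := by omega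
    have hm : m = i + k := by omega
    simp only [if_pos (show i ≤ m by omega), if_pos (show i ≤ m + 1 by omega), hk, hk']
    change f (i + k) (fw k) = f m (fw k)
    rw [hm]

/-- The vector `(V_{i-2}, V_{i-1}, W_{i-1})`. -/
def stateVector (V W : ℤ → R) (i : ℤ) : Fin 3 → R := ![V (i - 2), V (i - 1), W (i - 1)]

theorem IsSolution.stateVector_succ {V W : ℤ → R} (h : IsSolution a β V W) (i : ℤ) :
    stateVector V W (i + 1) = stepMatrix (a i) (β i) *ᵥ stateVector V W i := by
  obtain ⟨h1, h2⟩ := h i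
  funext j
  fin_cases j
  · simp [stateVector, stepMatrix, Matrix.mulVec, dotProduct, Fin.sum_univ_three]
    congr 1; ring
  · simp [stateVector, stepMatrix, Matrix.mulVec, dotProduct, Fin.sum_univ_three, h1]
    abel
  · simp [stateVector, stepMatrix, Matrix.mulVec, dotProduct, Fin.sum_univ_three, h2]
    abel

theorem IsSolution.stateVector_add {V W : ℤ → R} (h : IsSolution a β V W) (i : ℤ) (k : ℕ) :
    stateVector V W (i + k) = monodromy a β i k *ᵥ stateVector V W i := by
  induction k with
  | zero => simp [monodromy]
  | succ k ih =>
    push_cast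
    rw [← add_assoc, h.stateVector_succ, ih, monodromy, Matrix.mulVec_mulVec]

theorem exists_isSolution (hβ : ∀ i, β i * β i = 0) (i : ℤ) (v : Fin 3 → R) :
    ∃ V W, IsSolution a β V W ∧ stateVector V W i = v := by
  let f : ℤ → (Fin 3 → R) ≃ (Fin 3 → R) := fun m =>
    { toFun := fun w => stepMatrix (a m) (β m) *ᵥ w
      invFun := fun w => stepInv (a m) (β m) *ᵥ w
      left_inv := fun w => by
        change stepInv (a m) (β m) *ᵥ (stepMatrix (a m) (β m) *ᵥ w) = w
        rw [Matrix.mulVec_mulVec, stepInv_mul (hβ m), Matrix.one_mulVec]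
      right_inv := fun w => by
        change stepMatrix (a m) (β m) *ᵥ (stepInv (a m) (β m) *ᵥ w) = w
        rw [Matrix.mulVec_mulVec, mul_stepInv (hβ m), Matrix.one_mulVec] }
  obtain ⟨T, hT, hsucc⟩ := exists_int_orbit f i v
  have h0 : ∀ m, T m 0 = T (m - 1) 1 := fun m => by
    have := congrFun (hsucc (m - 1)) 0
    rw [sub_add_cancel] at this
    simpa [f, stepMatrix, Matrix.mulVec, dotProduct, Fin.sum_univ_three] using this
  have h1 : ∀ m, T (m + 1) 1 = -T m 0 + a m * T m 1 + -(β m * T m 2) := fun m => by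
    have := congrFun (hsucc m) 1
    simpa [f, stepMatrix, Matrix.mulVec, dotProduct, Fin.sum_univ_three] using this
  have h2 : ∀ m, T (m + 1) 2 = β m * T m 1 + T m 2 := fun m => by
    have := congrFun (hsucc m) 2
    simpa [f, stepMatrix, Matrix.mulVec, dotProduct, Fin.sum_univ_three] using this
  -- The coordinate `0` of the orbit repeats coordinate `1` one step earlier (`h0`), so `V` and `W`
  -- are read from coordinates `1` and `2`, with the shift built into `stateVector`.
  refine ⟨fun m => T (m + 1) 1, fun m => T (m + 1) 2, fun m => ⟨?_, ?_⟩, ?_⟩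
  · have e : m - 2 + 1 = m - 1 := by ring
    simp only [sub_add_cancel, e]
    rw [h1, h0]
    abel
  · simp only [sub_add_cancel]
    rw [h2, add_comm]
  · have e : i - 2 + 1 = i - 1 := by ring
    rw [← hT]
    funext j
    fin_cases j <;> simp [stateVector, e, h0 i]

/-- Solutions realize every state at `i`, so antiperiodicity fixes `M_i` on all vectors. Conversely
the matrix equation moves to every base point, and the shifts by `2` and `1` pick out `V j` and `W
j` from the state. -/
theorem forall_solution_iff (hβ : ∀ i, β i * β i = 0)
    (hp : ∀ i : ℤ, a (i + n) = a i ∧ β (i + n) = -β i) (i : ℤ) :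
    (∀ V W : ℤ → R, IsSolution a β V W → ∀ i : ℤ, V (i + n) = -V i ∧ W (i + n) = W i) ↔
      monodromy a β i n = hillMonodromy R := by
  constructor
  · intro h
    have hv : ∀ v, monodromy a β i n *ᵥ v = hillMonodromy R *ᵥ v := by
      intro v
      obtain ⟨V, W, hVW, rfl⟩ := exists_isSolution (a := a) hβ i v
      rw [← hVW.stateVector_add]
      have e1 : i + n - 2 = i - 2 + n := by ring
      have e2 : i + n - 1 = i - 1 + n := by ring
      funext j
      fin_cases j <;>
        simp [stateVector, hillMonodromy, Matrix.mulVec_diagonal, e1, e2, (h V W hVW _).1,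
          (h V W hVW _).2]
    exact Matrix.ext_of_mulVec_single fun j => hv _
  · intro h V W hVW j
    have hs : ∀ j : ℤ, stateVector V W (j + n) = hillMonodromy R *ᵥ stateVector V W j :=
      fun j => by rw [hVW.stateVector_add, (monodromy_eq_iff hβ hp j i).2 h]
    constructor
    · have := congrFun (hs (j + 2)) 0
      have e : j + 2 + n - 2 = j + n := by ring
      simpa [stateVector, hillMonodromy, Matrix.mulVec_diagonal, e] using this
    · have := congrFun (hs (j + 1)) 2
      have e : j + 1 + n - 1 = j + n := by ring
      simpa [stateVector, hillMonodromy, Matrix.mulVec_diagonal, e] using this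

end Monodromy

theorem isHillEquation_iff {K : Type u} [Field K] {R : Type v} [Ring R] [Algebra K R]
    (𝓡 : ZMod 2 → Submodule K R) [GradedAlgebra 𝓡] [IsSupercommutative 𝓡] {n : ℕ} {a β : ℤ → R}
    (h : IsPotential 𝓡 n a β) (i : ℤ) :
    IsHillEquation 𝓡 n a β ↔ monodromy a β i n = hillMonodromy R := by
  rw [IsHillEquation, and_iff_right h]
  exact forall_solution_iff
    (fun i => IsSupercommutative.odd_sq (𝓡 := 𝓡) _ (h i).2.1) (fun i => (h i).2.2) i

/-! ## Universal properties -/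

section Universal

variable {K : Type u} [Field K] {n : ℕ}

theorem universalA_mem (i : ℤ) : universalA K n i ∈ potentialGrading K n 0 :=
  (SetLike.algebraMap_mem_graded (CliffordAlgebra.evenOdd
    (0 : QuadraticForm (MvPolynomial (ZMod n) K) (ZMod n →₀ MvPolynomial (ZMod n) K))) _ :)

theorem ι_mem_odd {P M : Type*} [CommRing P] [AddCommGroup M] [Module P M] (m : M) :
    ExteriorAlgebra.ι P m ∈ CliffordAlgebra.evenOdd (0 : QuadraticForm P M) 1 :=
  CliffordAlgebra.ι_mem_evenOdd_one _ m

theorem universalB_mem (i : ℤ) : universalB K n i ∈ potentialGrading K n 1 :=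
  zsmul_mem (S := Submodule K (PotentialAlgebra K n)) (ι_mem_odd _) _

theorem isPotential_universal (hn : n ≠ 0) :
    IsPotential (potentialGrading K n) n (universalA K n) (universalB K n) := by
  intro i
  refine ⟨universalA_mem i, universalB_mem i, ?_, ?_⟩
  · simp [universalA]
  · rw [universalB, universalB, Int.add_ediv_of_dvd_right (dvd_refl _),
      Int.ediv_self (by exact_mod_cast hn), Int.negOnePow_succ]
    simp

variable {R : Type v} [Ring R] [Algebra K R] {𝓡 : ZMod 2 → Submodule K R}

/-- A shift by `n` flips both `β` and the parity of the quotient `i / n`, so their signed product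
depends only on the residue class. For `n = 0` residues are the integers themselves. -/
theorem IsPotential.eq_of_intCast_eq {a β : ℤ → R} (h : IsPotential 𝓡 n a β) {i j : ℤ}
    (hij : (i : ZMod n) = j) :
    a i = a j ∧ (Int.negOnePow (i / n) : ℤ) • β i = (Int.negOnePow (j / n) : ℤ) • β j := by
  rcases Nat.eq_zero_or_pos n with rfl | hn
  · obtain rfl : i = j := by exact_mod_cast hij
    exact ⟨rfl, rfl⟩
  have hn' : (n : ℤ) ≠ 0 := by exact_mod_cast hn.ne'
  have key : ∀ (k : ℕ) (i : ℤ), a (i + k * n) = a i ∧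
      (Int.negOnePow ((i + k * n) / n) : ℤ) • β (i + k * n) =
        (Int.negOnePow (i / n) : ℤ) • β i := by
    intro k i
    induction k with
    | zero => simp
    | succ k ih =>
      have e : i + (k + 1 : ℕ) * n = (i + k * n) + n := by push_cast; ring
      obtain ⟨-, -, h3, h4⟩ := h (i + k * n)
      rw [e, h3, h4, Int.add_ediv_of_dvd_right (dvd_refl _), Int.ediv_self hn',
        Int.negOnePow_succ, ← ih.2, ih.1]
      simp
  obtain ⟨c, hc⟩ := (ZMod.intCast_eq_intCast_iff_dvd_sub i j n).1 hij
  rcases le_total 0 c with h0 | h0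
  · lift c to ℕ using h0
    have e : j = i + c * n := by linear_combination hc
    rw [e]
    exact ⟨(key c i).1.symm, (key c i).2.symm⟩
  · obtain ⟨d, rfl⟩ : ∃ d : ℕ, c = -d := ⟨c.natAbs, by omega⟩
    have e : i = j + d * n := by linear_combination -hc
    rw [e]
    exact key d j

variable [GradedAlgebra 𝓡]

theorem IsPotential.map {a β : ℤ → R} {R' : Type*} [Ring R'] [Algebra K R']
    {𝓡' : ZMod 2 → Submodule K R'} [GradedAlgebra 𝓡'] (h : IsPotential 𝓡 n a β)
    (φ : 𝓡 →ₐᵍ[K] 𝓡') : IsPotential 𝓡' n (fun i => φ (a i)) (fun i => φ (β i)) := by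
  intro i
  obtain ⟨h1, h2, h3, h4⟩ := h i
  exact ⟨φ.map_mem h1, φ.map_mem h2, congrArg φ h3,
    (congrArg φ h4).trans (map_neg φ _)⟩

/-- A superalgebra homomorphism from the algebra of potentials is determined by the images of the
coordinates. -/
theorem potentialHom_ext {φ ψ : PotentialAlgebra K n →ₐ[K] R}
    (ha : ∀ i, φ (universalA K n i) = ψ (universalA K n i))
    (hb : ∀ i, φ (universalB K n i) = ψ (universalB K n i)) : φ = ψ := by
  have hP : ∀ p : MvPolynomial (ZMod n) K, φ (algebraMap _ _ p) = ψ (algebraMap _ _ p) := by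
    intro p
    induction p using MvPolynomial.induction_on with
    | C c =>
      rw [← MvPolynomial.algebraMap_eq, ← IsScalarTower.algebraMap_apply, AlgHom.commutes,
        AlgHom.commutes]
    | add p q hp hq => rw [map_add, map_add, map_add, hp, hq]
    | mul_X p i hp =>
      rw [map_mul, map_mul, map_mul, hp]
      obtain ⟨j, rfl⟩ := ZMod.intCast_surjective i
      congr 1
      exact ha j
  have hι : ∀ m, φ (ExteriorAlgebra.ι _ m) = ψ (ExteriorAlgebra.ι _ m) := by
    intro m
    induction m using Finsupp.induction_linear with
    | zero => simp
    | add f g hf hg => rw [map_add, map_add, map_add, hf, hg]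
    | single i p =>
      have : Finsupp.single i p = p • Finsupp.single i (1 : MvPolynomial (ZMod n) K) := by simp
      rw [this, map_smul, Algebra.smul_def, map_mul, map_mul, hP]
      congr 1
      obtain ⟨j, rfl⟩ := ZMod.intCast_surjective i
      have h := hb j
      rw [universalB, map_zsmul, map_zsmul] at h
      rcases Int.units_eq_one_or (j / n : ℤ).negOnePow with hu | hu <;> simpa [hu] using h
  refine AlgHom.ext fun x => ?_
  induction x using ExteriorAlgebra.induction with
  | algebraMap r => exact hP r
  | ι m => exact hι m
  | mul a b ha hb => rw [map_mul, map_mul, ha, hb]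
  | add a b ha hb => rw [map_add, map_add, ha, hb]

variable [IsSupercommutative 𝓡]

/-- Every potential over a supercommutative algebra is the image of the universal one. -/
theorem exists_hom_of_isPotential {a β : ℤ → R} (h : IsPotential 𝓡 n a β) :
    ∃ φ : potentialGrading K n →ₐᵍ[K] 𝓡,
      (∀ i, φ (universalA K n i) = a i) ∧ ∀ i, φ (universalB K n i) = β i := by
  let P := MvPolynomial (ZMod n) K
  let ev : P →ₐ[K] 𝓡 0 := MvPolynomial.aeval fun i : ZMod n =>
    (⟨a (i.cast : ℤ), (h _).1⟩ : 𝓡 0)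
  let ev' : P →ₐ[K] R := (evenSubtype 𝓡).comp ev
  have hev : ∀ p, ev' p ∈ 𝓡 0 := fun p => (ev p).2
  let : Algebra P R := RingHom.toAlgebra' ev'.toRingHom fun p x =>
    IsSupercommutative.even_comm (𝓡 := 𝓡) _ (hev p) x
  have halg : ∀ p, algebraMap P R p = ev' p := fun _ => rfl
  have hsmul : ∀ (p : P) (x : R), p • x = ev' p * x := fun p x => Algebra.smul_def p x
  have : IsScalarTower K P R := IsScalarTower.of_algebraMap_eq fun c => (ev'.commutes c).symm
  -- The sign makes `b` the residue-invariant combination of `IsPotential.eq_of_intCast_eq`,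
  -- matching the sign in `universalB`.
  let b : ZMod n → R := fun i => (Int.negOnePow ((i.cast : ℤ) / n) : ℤ) • β (i.cast : ℤ)
  have hb : ∀ i, b i ∈ 𝓡 1 := fun i => zsmul_mem (h _).2.1 _
  let f : (ZMod n →₀ P) →ₗ[P] R := Finsupp.linearCombination P b
  have hf1 : ∀ v, f v ∈ 𝓡 1 := fun v => by
    simp only [f, Finsupp.linearCombination_apply, Finsupp.sum]
    refine sum_mem fun i _ => ?_
    rw [hsmul]
    exact even_mul_odd 𝓡 (hev _) (hb i)
  have hf2 : ∀ v, f v * f v = 0 := fun v => IsSupercommutative.odd_sq (𝓡 := 𝓡) _ (hf1 v)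
  let Φ : PotentialAlgebra K n →ₐ[P] R := ExteriorAlgebra.lift P ⟨f, hf2⟩
  have hΦι : ∀ m, Φ (ExteriorAlgebra.ι P m) = f m := fun m => by simp [Φ]
  have hΦι' : ∀ m, Φ (CliffordAlgebra.ι (0 : QuadraticForm P (ZMod n →₀ P)) m) = f m := hΦι
  have hmul : ∀ m m' : ZMod n →₀ P, f m * f m' ∈ 𝓡 0 := fun m m' =>
    odd_mul_odd 𝓡 (hf1 m) (hf1 m')
  have h0 : ∀ x, x ∈ CliffordAlgebra.evenOdd (0 : QuadraticForm P (ZMod n →₀ P)) 0 →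
      Φ x ∈ 𝓡 0 := by
    intro x hx
    induction x, hx using CliffordAlgebra.even_induction with
    | algebraMap r => exact (Φ.commutes r).symm ▸ hev r
    | add x y _ _ hx hy => exact (map_add Φ x y).symm ▸ add_mem hx hy
    | ι_mul_ι_mul m m' x _ hx =>
      have e : Φ (CliffordAlgebra.ι (0 : QuadraticForm P (ZMod n →₀ P)) m *
          CliffordAlgebra.ι 0 m' * x) = f m * f m' * Φ x := by
        exact (map_mul Φ _ _).trans (congrArg (· * Φ x) ((map_mul Φ _ _).trans (by
          rw [hΦι', hΦι'])))
      rw [e]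
      exact even_mul_even 𝓡 (hmul m m') hx
  have h1 : ∀ x, x ∈ CliffordAlgebra.evenOdd (0 : QuadraticForm P (ZMod n →₀ P)) 1 →
      Φ x ∈ 𝓡 1 := by
    intro x hx
    induction x, hx using CliffordAlgebra.odd_induction with
    | ι m => exact (hΦι' m).symm ▸ hf1 m
    | add x y _ _ hx hy => exact (map_add Φ x y).symm ▸ add_mem hx hy
    | ι_mul_ι_mul m m' x _ hx =>
      have e : Φ (CliffordAlgebra.ι (0 : QuadraticForm P (ZMod n →₀ P)) m *
          CliffordAlgebra.ι 0 m' * x) = f m * f m' * Φ x := by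
        exact (map_mul Φ _ _).trans (congrArg (· * Φ x) ((map_mul Φ _ _).trans (by
          rw [hΦι', hΦι'])))
      rw [e]
      exact even_mul_odd 𝓡 (hmul m m') hx
  let φ : potentialGrading K n →ₐᵍ[K] 𝓡 :=
    { Φ.restrictScalars K with
      map_mem := by
        intro i x hx
        fin_cases i
        · exact h0 x hx
        · exact h1 x hx }
  refine ⟨φ, fun i => ?_, fun i => ?_⟩
  · have e1 : Φ (universalA K n i) = ev' (MvPolynomial.X (i : ZMod n)) := Φ.commutes _
    change Φ (universalA K n i) = _
    rw [e1]
    have e2 : ev (MvPolynomial.X (i : ZMod n)) = ⟨a ((i : ZMod n).cast : ℤ), (h _).1⟩ :=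
      MvPolynomial.aeval_X _ _
    change ((ev (MvPolynomial.X (i : ZMod n)) : 𝓡 0) : R) = _
    rw [e2]
    exact (h.eq_of_intCast_eq (by simp)).1
  · change Φ (universalB K n i) = _
    rw [universalB, map_zsmul, hΦι]
    simp only [f, Finsupp.linearCombination_single, one_smul, b]
    rw [(h.eq_of_intCast_eq (i := ((i : ZMod n).cast : ℤ)) (j := i) (by simp)).2]
    rcases Int.units_eq_one_or (i / n : ℤ).negOnePow with hu | hu <;> simp [hu]

theorem bijOn_potential (hn : n ≠ 0) :
    Set.BijOn
      (fun φ : potentialGrading K n →ₐᵍ[K] 𝓡 =>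
        ((fun i => φ (universalA K n i), fun i => φ (universalB K n i)) : (ℤ → R) × (ℤ → R)))
      Set.univ {p | IsPotential 𝓡 n p.1 p.2} := by
  refine ⟨fun φ _ => (isPotential_universal hn).map φ, fun φ _ ψ _ h => ?_, ?_⟩
  · have h1 := congrFun (congrArg Prod.fst h)
    have h2 := congrFun (congrArg Prod.snd h)
    have h3 : φ.toAlgHom = ψ.toAlgHom := potentialHom_ext h1 h2
    exact DFunLike.ext _ _ fun x => DFunLike.congr_fun h3 x
  · rintro ⟨a, β⟩ h
    obtain ⟨φ, h1, h2⟩ := exists_hom_of_isPotential h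
    exact ⟨φ, trivial, Prod.ext (funext h1) (funext h2)⟩

theorem map_monodromy {R R' : Type*} [Ring R] [Ring R'] (φ : R →+* R') (a β : ℤ → R) (i : ℤ)
    (k : ℕ) : (monodromy a β i k).map φ =
      monodromy (fun i => φ (a i)) (fun i => φ (β i)) i k := by
  induction k with
  | zero => simp [monodromy]
  | succ k ih =>
    rw [monodromy, Matrix.map_mul, ih, monodromy]
    congr 1
    ext p q
    fin_cases p <;> fin_cases q <;> simp [stepMatrix]

theorem map_hillMonodromy {R R' : Type*} [Ring R] [Ring R'] (φ : R →+* R') :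
    (hillMonodromy R).map φ = hillMonodromy R' := by
  ext p q
  fin_cases p <;> fin_cases q <;> simp [hillMonodromy]

/-- The quotient map as a homomorphism of superalgebras. -/
def hillMkGraded (K : Type u) [Field K] (n : ℕ) : potentialGrading K n →ₐᵍ[K] hillGrading K n :=
  { hillMk K n with map_mem := fun hx => superQuotMk_mem _ _ hx }

theorem hillMk_hillEquations {x : PotentialAlgebra K n} (hx : x ∈ hillEquations K n) :
    hillMk K n x = 0 := by
  rw [← zmod_two_decompose_add (potentialGrading K n) x, map_add,
    superQuotMk_component _ _ hx, superQuotMk_component _ _ hx, add_zero]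

theorem isHillEquation_universal (hn : n ≠ 0) :
    IsHillEquation (hillGrading K n) n (fun i => hillMk K n (universalA K n i))
      (fun i => hillMk K n (universalB K n i)) := by
  have hp : IsPotential (hillGrading K n) n (fun i => hillMk K n (universalA K n i))
      (fun i => hillMk K n (universalB K n i)) :=
    (isPotential_universal hn).map (hillMkGraded K n)
  rw [isHillEquation_iff _ hp 1]
  have h1 := map_monodromy (hillMk K n).toRingHom (universalA K n) (universalB K n) 1 n
  refine h1.symm.trans ?_
  rw [← map_hillMonodromy (hillMk K n).toRingHom]
  ext p q
  have := hillMk_hillEquations (K := K) (n := n) ⟨(p, q), rfl⟩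
  rw [map_sub, sub_eq_zero] at this
  exact this

/-- Every supersymmetric Hill equation is the image of the universal one. -/
theorem exists_hom_of_isHillEquation {a β : ℤ → R} (h : IsHillEquation 𝓡 n a β) :
    ∃ φ : hillGrading K n →ₐᵍ[K] 𝓡,
      (∀ i, φ (hillMk K n (universalA K n i)) = a i) ∧
        ∀ i, φ (hillMk K n (universalB K n i)) = β i := by
  obtain ⟨φ, h1, h2⟩ := exists_hom_of_isPotential h.1
  have hM := (isHillEquation_iff 𝓡 h.1 1).1 h
  have hφ0 : ∀ g ∈ hillEquations K n, φ g = 0 := by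
    rintro _ ⟨⟨p, q⟩, rfl⟩
    have h3 := map_monodromy φ.toAlgHom.toRingHom (universalA K n) (universalB K n) 1 n
    have h4 : monodromy (fun i => φ (universalA K n i)) (fun i => φ (universalB K n i)) 1 n =
        (hillMonodromy _).map φ.toAlgHom.toRingHom := by
      rw [funext h1, funext h2, hM, map_hillMonodromy]
    have h5 := congrFun (congrFun (h3.trans h4) p) q
    rw [map_sub, sub_eq_zero]
    exact h5
  have hφ : ∀ ⦃x y⦄, superRel (potentialGrading K n) (hillEquations K n) x y →
      φ.toAlgHom x = φ.toAlgHom y := by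
    rintro _ _ ⟨rfl, g, hg, i, rfl⟩
    have hg0 := hφ0 g hg
    rw [← zmod_two_decompose_add (potentialGrading K n) g, map_add] at hg0
    -- The relations kill homogeneous components separately; since `φ` respects parity, `φ g = 0`
    -- splits into its two components.
    have hz := even_odd_unique 𝓡 (φ.map_mem (decompose (potentialGrading K n) g 0).2)
      (zero_mem _) (φ.map_mem (decompose (potentialGrading K n) g 1).2) (zero_mem _)
      (hg0.trans (add_zero 0).symm)
    rw [map_zero]
    fin_cases i
    · exact hz.1
    · exact hz.2
  let ψ : HillAlgebra K n →ₐ[K] R := RingQuot.liftAlgHom K ⟨φ.toAlgHom, hφ⟩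
  have hψ : ∀ x, ψ (hillMk K n x) = φ x := fun x =>
    RingQuot.liftAlgHom_mkAlgHom_apply K φ.toAlgHom hφ x
  refine ⟨{ ψ with map_mem := ?_ }, fun i => (hψ _).trans (h1 i), fun i => (hψ _).trans (h2 i)⟩
  rintro i _ ⟨x, hx, rfl⟩
  exact (hψ x).symm ▸ φ.map_mem hx

theorem bijOn_hill (hn : n ≠ 0) :
    Set.BijOn
      (fun φ : hillGrading K n →ₐᵍ[K] 𝓡 =>
        ((fun i => φ (hillMk K n (universalA K n i)),
          fun i => φ (hillMk K n (universalB K n i))) : (ℤ → R) × (ℤ → R)))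
      Set.univ {p | IsHillEquation 𝓡 n p.1 p.2} := by
  refine ⟨fun φ _ => ?_, fun φ _ ψ _ h => ?_, ?_⟩
  · have hu := isHillEquation_universal (K := K) hn
    have hp := hu.1.map φ
    have hM := (isHillEquation_iff _ hu.1 1).1 hu
    refine (isHillEquation_iff 𝓡 hp 1).2 ?_
    refine (map_monodromy φ.toAlgHom.toRingHom _ _ 1 n).symm.trans ?_
    rw [hM, map_hillMonodromy]
  · have h1 := congrFun (congrArg Prod.fst h)
    have h2 := congrFun (congrArg Prod.snd h)
    have h3 : φ.toAlgHom.comp (hillMk K n) = ψ.toAlgHom.comp (hillMk K n) :=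
      potentialHom_ext h1 h2
    refine DFunLike.ext _ _ fun x => ?_
    obtain ⟨y, rfl⟩ := superQuotMk_surjective _ _ x
    exact DFunLike.congr_fun h3 y
  · rintro ⟨a, β⟩ h
    obtain ⟨φ, h1, h2⟩ := exists_hom_of_isHillEquation h
    exact ⟨φ, trivial, Prod.ext (funext h1) (funext h2)⟩

end Universal

/-! ## Even and odd elements of exterior algebras -/

section Exterior

variable {P M : Type u} [CommRing P] [AddCommGroup M] [Module P M]

/-- A monomial of positive even degree is (odd)·(odd) and squares to zero, and even elements
commute, so sums of such terms remain nilpotent. Up to nilpotents the even part is thus generated by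
the even coordinates. -/
theorem exists_isNilpotent_sub_algebraMap (x : ExteriorAlgebra P M)
    (hx : x ∈ CliffordAlgebra.evenOdd (0 : QuadraticForm P M) 0) :
    ∃ p : P, IsNilpotent (x - algebraMap P (ExteriorAlgebra P M) p) := by
  induction x, hx using CliffordAlgebra.even_induction with
  | algebraMap r => exact ⟨r, by rw [sub_self]; exact IsNilpotent.zero⟩
  | add x y hx hy h h' =>
    obtain ⟨p, hp⟩ := h
    obtain ⟨q, hq⟩ := h'
    refine ⟨p + q, ?_⟩
    have e : x + y - algebraMap P (ExteriorAlgebra P M) (p + q) =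
        (x - algebraMap P (ExteriorAlgebra P M) p) + (y - algebraMap P (ExteriorAlgebra P M) q) := by
      rw [map_add, add_sub_add_comm]
    rw [e]
    refine Commute.isNilpotent_add ?_ hp hq
    have hc : ∀ z : ExteriorAlgebra P M, Commute (x - algebraMap P (ExteriorAlgebra P M) p) z :=
      fun z => Commute.sub_left (exterior_even_comm x hx z) (Algebra.commutes p z)
    exact hc _
  | ι_mul_ι_mul m m' x hx _ =>
    refine ⟨0, 2, ?_⟩
    have hodd : CliffordAlgebra.ι (0 : QuadraticForm P M) m' * x ∈
        CliffordAlgebra.evenOdd (0 : QuadraticForm P M) 1 := by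
      simpa using SetLike.GradedMul.mul_mem (A := CliffordAlgebra.evenOdd (0 : QuadraticForm P M))
        (CliffordAlgebra.ι_mem_evenOdd_one _ m') hx
    have e := exterior_odd_anticomm _ hodd _ (CliffordAlgebra.ι_mem_evenOdd_one _ m)
    have e2 := exterior_odd_sq _ hodd
    rw [map_zero, sub_zero, pow_two, mul_assoc (CliffordAlgebra.ι (0 : QuadraticForm P M) m)]
    set y := CliffordAlgebra.ι (0 : QuadraticForm P M) m' * x
    set z := CliffordAlgebra.ι (0 : QuadraticForm P M) m
    calc z * y * (z * y) = z * (y * z) * y := by noncomm_ring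
      _ = -(z * z * (y * y)) := by rw [e]; noncomm_ring
      _ = 0 := by rw [e2, mul_zero, neg_zero]

theorem exists_eq_sum_mul_ι {σ : Type u} [Fintype σ] (b : Module.Basis σ P M)
    (x : ExteriorAlgebra P M) (hx : x ∈ CliffordAlgebra.evenOdd (0 : QuadraticForm P M) 1) :
    ∃ c : σ → ExteriorAlgebra P M,
      (∀ i, c i ∈ CliffordAlgebra.evenOdd (0 : QuadraticForm P M) 0) ∧
        x = ∑ i, c i * ExteriorAlgebra.ι P (b i) := by
  induction x, hx using CliffordAlgebra.odd_induction with
  | ι v =>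
    refine ⟨fun i => algebraMap P _ (b.repr v i), fun i => SetLike.algebraMap_mem_graded _ _, ?_⟩
    refine (congrArg (ExteriorAlgebra.ι P) (b.sum_repr v)).symm.trans ?_
    rw [map_sum]
    exact Finset.sum_congr rfl fun i _ => by rw [map_smul, Algebra.smul_def]
  | add x y _ _ h h' =>
    obtain ⟨c, hc, rfl⟩ := h
    obtain ⟨d, hd, rfl⟩ := h'
    exact ⟨c + d, fun i => add_mem (hc i) (hd i), by
      simp only [Pi.add_apply, add_mul, Finset.sum_add_distrib]⟩
  | ι_mul_ι_mul m m' x _ h =>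
    obtain ⟨c, hc, rfl⟩ := h
    refine ⟨fun i => CliffordAlgebra.ι (0 : QuadraticForm P M) m * CliffordAlgebra.ι 0 m' * c i,
      fun i => ?_, ?_⟩
    · simpa using SetLike.GradedMul.mul_mem (A := CliffordAlgebra.evenOdd (0 : QuadraticForm P M))
        (CliffordAlgebra.ι_mul_ι_mem_evenOdd_zero _ m m') (hc i)
    · exact (Finset.mul_sum _ _ _).trans (Finset.sum_congr rfl fun i _ => (mul_assoc _ _ _).symm)

end Exterior

/-! ### Units and the top form in exterior algebras over a field. -/

section ExteriorField

variable {L M : Type u} [Field L] [AddCommGroup M] [Module L M]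

/-- An even element is its scalar part plus a commuting nilpotent. -/
theorem isUnit_of_algebraMapInv_ne_zero (x : ExteriorAlgebra L M)
    (hx : x ∈ CliffordAlgebra.evenOdd (0 : QuadraticForm L M) 0)
    (h : ExteriorAlgebra.algebraMapInv x ≠ 0) : IsUnit x := by
  obtain ⟨p, hp⟩ := exists_isNilpotent_sub_algebraMap x hx
  have h1 := (hp.map (ExteriorAlgebra.algebraMapInv (R := L) (M := M))).eq_zero
  rw [map_sub, ExteriorAlgebra.algebraMap_leftInverse M p, sub_eq_zero] at h1
  have hu : IsUnit (algebraMap L (ExteriorAlgebra L M) p) :=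
    (isUnit_iff_ne_zero.2 (h1 ▸ h)).map _
  have := hp.isUnit_add_left_of_commute hu (Algebra.commutes p _).symm
  rwa [add_sub_cancel] at this

/-- The determinant, extended by zero to other degrees, takes the value `1` on this product. -/
theorem prod_ι_single_ne_zero (q : ℕ) :
    (List.ofFn fun k : Fin q => ExteriorAlgebra.ι L (Pi.single k 1 : Fin q → L)).prod ≠ 0 := by
  intro h
  have h1 := ExteriorAlgebra.liftAlternating_apply_ιMulti (R := L) (M := Fin q → L) (N := L)
    (Pi.single q (Pi.basisFun L (Fin q)).det) (fun k => Pi.single k 1)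
  rw [ExteriorAlgebra.ιMulti_apply, h, map_zero, Pi.single_eq_same] at h1
  have h2 := (Pi.basisFun L (Fin q)).det_self
  rw [show ((Pi.basisFun L (Fin q)) : Fin q → Fin q → L) = fun k => Pi.single k 1 from
    funext fun k => Pi.basisFun_apply L (Fin q) k, ← h1] at h2
  exact zero_ne_one h2

end ExteriorField

/-- The grading of an exterior algebra over an extension of `K`. -/
abbrev exteriorGrading (K L M : Type u) [Field K] [Field L] [Algebra K L] [AddCommGroup M]
    [Module L M] [Module K M] [IsScalarTower K L M] (i : ZMod 2) : Submodule K (ExteriorAlgebra L M) :=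
  (CliffordAlgebra.evenOdd (0 : QuadraticForm L M) i).restrictScalars K

instance exteriorSupercommutative (K L M : Type u) [Field K] [Field L] [Algebra K L]
    [AddCommGroup M] [Module L M] [Module K M] [IsScalarTower K L M] :
    IsSupercommutative (exteriorGrading K L M) where
  even_comm := fun x hx y => exterior_even_comm x hx y
  odd_anticomm := fun x hx y hy => exterior_odd_anticomm x hx y hy
  odd_sq := fun x hx => exterior_odd_sq x hx

/-! ## Dimension bounds for quotients of the algebra of potentials -/

section Bounds

variable {K : Type u} [Field K] {R : Type v} [Ring R] [Algebra K R]
  {𝓡 : ZMod 2 → Submodule K R} [GradedAlgebra 𝓡]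

theorem exists_homogeneous_preimage {n : ℕ} (π : potentialGrading K n →ₐᵍ[K] 𝓡)
    (hπ : Function.Surjective π) {i : ZMod 2} {x : R} (hx : x ∈ 𝓡 i) :
    ∃ y ∈ potentialGrading K n i, π y = x := by
  obtain ⟨y, rfl⟩ := hπ x
  have h := zmod_two_decompose_add (potentialGrading K n) y
  set y0 := decompose (potentialGrading K n) y 0
  set y1 := decompose (potentialGrading K n) y 1
  have h' : π y0 + π y1 = π y := by rw [← map_add, h]
  fin_cases i
  · exact ⟨y0, y0.2, (even_odd_unique 𝓡 (π.map_mem y0.2) hx (π.map_mem y1.2) (zero_mem _)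
      (h'.trans (add_zero _).symm)).1⟩
  · exact ⟨y1, y1.2, (even_odd_unique 𝓡 (π.map_mem y0.2) (zero_mem _) (π.map_mem y1.2) hx
      (h'.trans (zero_add _).symm)).2⟩

/-- The odd coordinates of the space of potentials. -/
def oddCoord (K : Type u) [Field K] (n : ℕ) (i : ZMod n) : PotentialAlgebra K n :=
  ExteriorAlgebra.ι (MvPolynomial (ZMod n) K) (Finsupp.single i 1)

theorem exists_eq_sum_mul_oddCoord {n : ℕ} [NeZero n]
    (π : potentialGrading K n →ₐᵍ[K] 𝓡) (hπ : Function.Surjective π) {x : R}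
    (hx : x ∈ 𝓡 1) :
    ∃ c : ZMod n → 𝓡 0, x = ∑ i, (c i : R) * π (oddCoord K n i) := by
  obtain ⟨y, hy, rfl⟩ := exists_homogeneous_preimage π hπ hx
  let e : ULift.{u} (ZMod n) ≃ ZMod n := Equiv.ulift
  obtain ⟨c, hc, hyc⟩ := exists_eq_sum_mul_ι
    ((Finsupp.basisSingleOne (R := MvPolynomial (ZMod n) K) (ι := ZMod n)).reindex e.symm) y hy
  refine ⟨fun i => ⟨π (c (e.symm i)), π.map_mem (hc _)⟩, ?_⟩
  rw [hyc, map_sum, ← e.symm.sum_comp]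
  refine Finset.sum_congr rfl fun i _ => ?_
  rw [map_mul]
  simp [oddCoord]

variable [IsSupercommutative 𝓡]

/-- The restriction of a homomorphism of superalgebras to the even parts. -/
def evenMap {R' : Type*} [Ring R'] [Algebra K R'] {𝓡' : ZMod 2 → Submodule K R'}
    [GradedAlgebra 𝓡'] [IsSupercommutative 𝓡'] (φ : 𝓡 →ₐᵍ[K] 𝓡') : 𝓡 0 →ₐ[K] 𝓡' 0 where
  toFun x := ⟨φ x, φ.map_mem x.2⟩
  map_one' := Subtype.ext (map_one φ)
  map_mul' x y := Subtype.ext (map_mul φ (x : R) y)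
  map_zero' := Subtype.ext (map_zero φ)
  map_add' x y := Subtype.ext (map_add φ (x : R) y)
  commutes' c := Subtype.ext (φ.commutes c)

variable {n : ℕ}

/-- The even coordinates of the space of potentials. -/
def potentialCoord (K : Type u) [Field K] (n : ℕ) :
    MvPolynomial (ZMod n) K →ₐ[K] potentialGrading K n 0 where
  toFun p := ⟨algebraMap _ _ p, (SetLike.algebraMap_mem_graded (CliffordAlgebra.evenOdd
    (0 : QuadraticForm (MvPolynomial (ZMod n) K) (ZMod n →₀ MvPolynomial (ZMod n) K))) p :)⟩
  map_one' := Subtype.ext (map_one _)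
  map_mul' x y := Subtype.ext (map_mul _ x y)
  map_zero' := Subtype.ext (map_zero _)
  map_add' x y := Subtype.ext (map_add _ x y)
  commutes' c := Subtype.ext (IsScalarTower.algebraMap_apply K (MvPolynomial (ZMod n) K)
    (PotentialAlgebra K n) c).symm

variable (π : potentialGrading K n →ₐᵍ[K] 𝓡)

theorem exists_isNilpotent_sub_coord (hπ : Function.Surjective π) (t : 𝓡 0) :
    ∃ p, IsNilpotent (t - (evenMap π).comp (potentialCoord K n) p) := by
  obtain ⟨y, hy, hyt⟩ := exists_homogeneous_preimage π hπ t.2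
  obtain ⟨p, hp⟩ := exists_isNilpotent_sub_algebraMap y hy
  refine ⟨p, (isNilpotent_even_iff 𝓡 _).2 ?_⟩
  have h1 : IsNilpotent (π (y - algebraMap _ _ p)) := IsNilpotent.map (f := π) hp
  rw [map_sub, hyt] at h1
  exact h1

/-- Upper bound for the dimension of quotients of the even part. -/
theorem ringKrullDim_even_quotient_le {R : Type u} [Ring R] [Algebra K R]
    {𝓡 : ZMod 2 → Submodule K R} [GradedAlgebra 𝓡] [IsSupercommutative 𝓡] [NeZero n]
    (π : potentialGrading K n →ₐᵍ[K] 𝓡) (hπ : Function.Surjective π) (I : Ideal (𝓡 0)) (d : ℕ)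
    (hd : ∀ (F : Type u) [Field F] [Algebra K F] (g : 𝓡 0 →ₐ[K] F), (∀ x ∈ I, g x = 0) →
      ∃ s : Finset F, s.card ≤ d ∧ ∀ i, g (evenMap π (potentialCoord K n (MvPolynomial.X i))) ∈
        IntermediateField.adjoin K (s : Set F)) :
    ringKrullDim (𝓡 0 ⧸ I) ≤ d := by
  refine ringKrullDim_le_of_forall_field
    ((Ideal.Quotient.mkₐ K I).comp ((evenMap π).comp (potentialCoord K n))) ?_ d ?_
  · intro t
    obtain ⟨t, rfl⟩ := Ideal.Quotient.mk_surjective t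
    obtain ⟨p, hp⟩ := exists_isNilpotent_sub_coord π hπ t
    exact ⟨p, hp.map (Ideal.Quotient.mk I)⟩
  · intro F _ _ g
    exact hd F (g.comp (Ideal.Quotient.mkₐ K I)) fun x hx => by
      change g (Ideal.Quotient.mk I x) = 0
      rw [Ideal.Quotient.eq_zero_iff_mem.2 hx, map_zero]

theorem ringKrullDim_even_le {R : Type u} [Ring R] [Algebra K R]
    {𝓡 : ZMod 2 → Submodule K R} [GradedAlgebra 𝓡] [IsSupercommutative 𝓡] [NeZero n]
    (π : potentialGrading K n →ₐᵍ[K] 𝓡) (hπ : Function.Surjective π) (d : ℕ)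
    (hd : ∀ (F : Type u) [Field F] [Algebra K F] (g : 𝓡 0 →ₐ[K] F),
      ∃ s : Finset F, s.card ≤ d ∧ ∀ i, g (evenMap π (potentialCoord K n (MvPolynomial.X i))) ∈
        IntermediateField.adjoin K (s : Set F)) :
    ringKrullDim (𝓡 0) ≤ d := by
  rw [ringKrullDim_eq_of_ringEquiv (RingEquiv.quotientBot (𝓡 0)).symm]
  exact ringKrullDim_even_quotient_le π hπ ⊥ d fun F _ _ g _ => hd F g

/-- Lower bound for the dimension of the quotient by the annihilator of a product of odd elements,
from a point with values in an exterior algebra over a field. -/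
theorem le_ringKrullDim_quotient_evenAnnihilator {R : Type u} [Ring R] [Algebra K R]
    {𝓡 : ZMod 2 → Submodule K R} [GradedAlgebra 𝓡] [IsSupercommutative 𝓡] [NeZero n]
    (π : potentialGrading K n →ₐᵍ[K] 𝓡) (hπ : Function.Surjective π)
    {L : Type u} [Field L] [Algebra K L] {q : ℕ} (φ : 𝓡 →ₐᵍ[K] exteriorGrading K L (Fin q → L))
    (y : Fin q → R) (hy : ∀ k, φ (y k) = ExteriorAlgebra.ι L (Pi.single k 1))
    {d : ℕ} (x : Fin d → 𝓡 0) (x' : Fin d → L)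
    (hx : ∀ i, φ (x i) = algebraMap L _ (x' i)) (hx' : AlgebraicIndependent K x') :
    (d : WithBot ℕ∞) ≤ ringKrullDim (𝓡 0 ⧸ evenAnnihilator 𝓡 (List.ofFn y).prod) := by
  set I := evenAnnihilator 𝓡 (List.ofFn y).prod with hI
  let inv : ExteriorAlgebra L (Fin q → L) →ₐ[K] L :=
    (ExteriorAlgebra.algebraMapInv (R := L) (M := Fin q → L)).restrictScalars K
  let g : 𝓡 0 →ₐ[K] L := (inv.comp φ.toAlgHom).comp (evenSubtype 𝓡)
  -- If `t` had nonzero scalar part under `φ`, then `φ t` would be a unit annihilating the top form.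
  -- So the scalar part of `φ` factors through the quotient by the annihilator.
  have hg : ∀ t ∈ I, g t = 0 := by
    intro t ht
    by_contra hne
    have hu : IsUnit (φ (t : R)) := isUnit_of_algebraMapInv_ne_zero _ (φ.map_mem t.2) hne
    have h1 : (t : R) * (List.ofFn y).prod = 0 := ht
    have h2 := congrArg φ h1
    rw [map_mul, map_zero, hu.mul_right_eq_zero, map_list_prod, List.map_ofFn] at h2
    refine prod_ι_single_ne_zero (L := L) q ?_
    rw [← h2]
    congr 2
    funext k
    exact (hy k).symm
  let G : (𝓡 0 ⧸ I) →ₐ[K] L := Ideal.Quotient.liftₐ I g hg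
  refine le_ringKrullDim_of_algebraicIndependent
    ((Ideal.Quotient.mkₐ K I).comp ((evenMap π).comp (potentialCoord K n))) ?_ G
    (fun i => Ideal.Quotient.mk I (x i)) ?_
  · intro t
    obtain ⟨t, rfl⟩ := Ideal.Quotient.mk_surjective t
    obtain ⟨p, hp⟩ := exists_isNilpotent_sub_coord π hπ t
    exact ⟨p, hp.map (Ideal.Quotient.mk I)⟩
  · convert hx' using 2 with i
    change ExteriorAlgebra.algebraMapInv (φ (x i)) = x' i
    rw [hx]
    exact ExteriorAlgebra.algebraMap_leftInverse _ _

/-- A quotient has at most the dimension of the ring, so one family of odd elements whose quotient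
reaches `d` settles the even dimension and the attainment of `q` together. -/
theorem hasSuperdimension_of_bounds {d q : ℕ} (hle : ringKrullDim (𝓡 0) ≤ d)
    (hlow : ∃ y : Fin q → R, (∀ i, y i ∈ 𝓡 1) ∧
      (d : WithBot ℕ∞) ≤ ringKrullDim (𝓡 0 ⧸ evenAnnihilator 𝓡 (List.ofFn y).prod))
    (hup : ∀ s : ℕ, q < s → ∀ y : Fin s → R, (∀ i, y i ∈ 𝓡 1) →
      ringKrullDim (𝓡 0 ⧸ evenAnnihilator 𝓡 (List.ofFn y).prod) ≠ d) :
    HasSuperdimension 𝓡 d q := by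
  obtain ⟨y, hy, hyd⟩ := hlow
  have h1 := ringKrullDim_quotient_le (evenAnnihilator 𝓡 (List.ofFn y).prod)
  have h2 : ringKrullDim (𝓡 0) = d := le_antisymm hle (hyd.trans h1)
  refine ⟨h2, ⟨y, hy, le_antisymm h1 (h2 ▸ hyd)⟩, ?_⟩
  rintro s ⟨y, hy, hyd⟩
  by_contra hs
  exact hup s (not_le.1 hs) y hy (hyd.trans h2)

end Bounds

theorem algebraicIndependent_X_fractionRing (K : Type u) [Field K] (σ : Type*) :
    AlgebraicIndependent K fun i : σ =>
      algebraMap (MvPolynomial σ K) (FractionRing (MvPolynomial σ K)) (MvPolynomial.X i) :=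
  (MvPolynomial.algebraicIndependent_X σ K).map'
    (f := IsScalarTower.toAlgHom K _ (FractionRing (MvPolynomial σ K)))
    (IsFractionRing.injective _ _)

theorem ringKrullDim_quotient_eq_bot {R : Type*} [CommRing R] {I : Ideal R} (h : (1 : R) ∈ I) :
    ringKrullDim (R ⧸ I) = ⊥ := by
  have := Ideal.Quotient.subsingleton_iff.2 ((Ideal.eq_top_iff_one I).2 h)
  exact ringKrullDim_eq_bot_of_subsingleton

/-! ## The space of potentials -/

section PeriodicExtension

variable {R : Type v}

/-- The `n`-periodic sequence with prescribed values at `0, …, n - 1`. -/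
def periodicExt (n : ℕ) (a : ℕ → R) (i : ℤ) : R := a (i % n).toNat

theorem periodicExt_natCast {n k : ℕ} (hk : k < n) (a : ℕ → R) : periodicExt n a k = a k := by
  rw [periodicExt, Int.emod_eq_of_lt (by omega) (by exact_mod_cast hk), Int.toNat_natCast]

variable [Ring R]

/-- The `n`-antiperiodic sequence with prescribed values at `0, …, n - 1`. -/
def antiperiodicExt (n : ℕ) (b : ℕ → R) (i : ℤ) : R :=
  (Int.negOnePow (i / n) : ℤ) • b (i % n).toNat

theorem antiperiodicExt_natCast {n k : ℕ} (hk : k < n) (b : ℕ → R) :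
    antiperiodicExt n b k = b k := by
  rw [antiperiodicExt, Int.emod_eq_of_lt (by omega) (by exact_mod_cast hk), Int.toNat_natCast,
    Int.ediv_eq_zero_of_lt (by omega) (by exact_mod_cast hk)]
  simp

theorem isPotential_periodicExt {K : Type u} [Field K] [Algebra K R] (𝓡 : ZMod 2 → Submodule K R)
    {n : ℕ} (hn : n ≠ 0) {a b : ℕ → R} (ha : ∀ k, a k ∈ 𝓡 0) (hb : ∀ k, b k ∈ 𝓡 1) :
    IsPotential 𝓡 n (periodicExt n a) (antiperiodicExt n b) := by
  intro i
  refine ⟨ha _, zsmul_mem (hb _) _, ?_, ?_⟩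
  · simp [periodicExt]
  · rw [antiperiodicExt, antiperiodicExt, Int.add_ediv_of_dvd_right (dvd_refl _),
      Int.ediv_self (by exact_mod_cast hn), Int.negOnePow_succ]
    simp

end PeriodicExtension

section

variable (K : Type u) [Field K] (n : ℕ)

/-- The lower bound comes from the generic point: `n` independent scalars and `n` exterior
generators. More than `n` odd elements multiply to zero, so their quotient is the zero ring, of
dimension `⊥`. -/
theorem hasSuperdimension_potential (hn : n ≠ 0) :
    HasSuperdimension (potentialGrading K n) n n := by
  have : NeZero n := ⟨hn⟩
  let π : potentialGrading K n →ₐᵍ[K] potentialGrading K n := GradedAlgHom.id K _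
  have hπ : Function.Surjective π := fun x => ⟨x, rfl⟩
  refine hasSuperdimension_of_bounds ?_ ?_ ?_
  · refine ringKrullDim_even_le π hπ n fun F _ _ g => ?_
    classical
    refine ⟨Finset.univ.image fun i : ZMod n =>
      g (evenMap π (potentialCoord K n (MvPolynomial.X i))), Finset.card_image_le.trans ?_,
      fun i => IntermediateField.subset_adjoin _ _ (by simp)⟩
    simp
  · let L := FractionRing (MvPolynomial (Fin n) K)
    let x' : Fin n → L := fun i => algebraMap (MvPolynomial (Fin n) K) L (MvPolynomial.X i)
    let Λ := ExteriorAlgebra L (Fin n → L)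
    let a : ℕ → Λ := fun k => if h : k < n then algebraMap L Λ (x' ⟨k, h⟩) else 0
    let b : ℕ → Λ := fun k => if h : k < n then ExteriorAlgebra.ι L (Pi.single ⟨k, h⟩ 1) else 0
    have ha : ∀ k, a k ∈ exteriorGrading K L (Fin n → L) 0 := fun k => by
      by_cases h : k < n
      · simp only [a, dif_pos h]
        exact (SetLike.algebraMap_mem_graded (CliffordAlgebra.evenOdd
          (0 : QuadraticForm L (Fin n → L))) _ :)
      · simp only [a, dif_neg h]; exact zero_mem _
    have hb : ∀ k, b k ∈ exteriorGrading K L (Fin n → L) 1 := fun k => by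
      by_cases h : k < n
      · simp only [b, dif_pos h]
        exact ι_mem_odd _
      · simp only [b, dif_neg h]; exact zero_mem _
    obtain ⟨φ, hφa, hφb⟩ := exists_hom_of_isPotential
      (isPotential_periodicExt (exteriorGrading K L (Fin n → L)) hn ha hb)
    refine ⟨fun k => universalB K n (k : ℕ), fun k => universalB_mem _, ?_⟩
    refine le_ringKrullDim_quotient_evenAnnihilator π hπ φ _ (fun k => ?_)
      (fun k => ⟨universalA K n (k : ℕ), universalA_mem _⟩) x' (fun k => ?_)
      (algebraicIndependent_X_fractionRing K (Fin n))
    · rw [hφb, antiperiodicExt_natCast k.2]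
      exact dif_pos k.2
    · refine (hφa _).trans ?_
      rw [periodicExt_natCast k.2]
      exact dif_pos k.2
  · intro s hs y hy
    have hc := fun j => exists_eq_sum_mul_oddCoord π hπ (hy j)
    choose c hc using hc
    have hz := prod_odd_eq_zero (potentialGrading K n) (fun i => π (oddCoord K n i))
      (fun i => ι_mem_odd _) (by rwa [ZMod.card]) y c hc
    rw [ringKrullDim_quotient_eq_bot]
    · exact WithBot.bot_ne_coe
    · change ((1 : potentialGrading K n 0) : PotentialAlgebra K n) * _ = 0
      rw [hz, mul_zero]

end

/-! ## Upper bounds for the dimension of the space of Hill equations -/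

theorem monodromy_zero_eq_slMonodromy {F : Type*} [Ring F] (a : ℤ → F) (i : ℤ) (k : ℕ)
    (p q : Fin 2) : monodromy a 0 i k p.castSucc q.castSucc =
      slMonodromy (fun l => a (i + l)) k p q := by
  induction k generalizing p q with
  | zero =>
    fin_cases p <;> fin_cases q <;> simp [monodromy, slMonodromy]
  | succ k ih =>
    have h0 := ih 0 q
    have h1 := ih 1 q
    have e0 : (Fin.castSucc 0 : Fin 3) = 0 := rfl
    have e1 : (Fin.castSucc 1 : Fin 3) = 1 := rfl
    rw [e0] at h0
    rw [e1] at h1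
    fin_cases p <;>
      simp [monodromy, slMonodromy, Matrix.mul_apply, Fin.sum_univ_three, Fin.sum_univ_two,
        stepMatrix, slStep, h0, h1]

/-- These middle row and column entries are simple enough to solve for the coefficients. They serve
both the bound on odd parameters and the construction of a generic point. -/
theorem three_inv_steps_entries {R : Type*} [Ring R] (a b c α β γ : R) :
    (stepInv a α * (stepInv b β * (stepInv c γ * hillMonodromy R))) 1 1 = b ∧
      (stepInv a α * (stepInv b β * (stepInv c γ * hillMonodromy R))) 1 2 = -(b * γ) - β ∧
      (stepInv a α * (stepInv b β * (stepInv c γ * hillMonodromy R))) 2 1 = -(α * b) - β ∧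
      (stepInv a α * (stepInv b β * (stepInv c γ * hillMonodromy R))) 1 0 = 1 - b * c - β * γ ∧
      (stepInv a α * (stepInv b β * (stepInv c γ * hillMonodromy R))) 0 1 =
        a * b - 1 + α * β := by
  refine ⟨?_, ?_, ?_, ?_, ?_⟩ <;>
    simp [stepInv, hillMonodromy, Matrix.mul_apply, Matrix.vecMul_diagonal,
      Fin.sum_univ_three, sub_eq_add_neg]
  all_goals abel

theorem three_steps_entries {R : Type*} [Ring R] {a b c α β γ : R} (hα : α * α = 0)
    (hβ : β * β = 0) (hγ : γ * γ = 0) {T : Matrix (Fin 3) (Fin 3) R}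
    (h : stepMatrix c γ * (stepMatrix b β * (stepMatrix a α * T)) = hillMonodromy R) :
    T 1 1 = b ∧ T 1 2 = -(b * γ) - β ∧ T 2 1 = -(α * b) - β := by
  have hT : T = stepInv a α * (stepInv b β * (stepInv c γ * hillMonodromy R)) := by
    rw [← h, ← mul_assoc (stepInv c γ), stepInv_mul hγ, one_mul, ← mul_assoc (stepInv b β),
      stepInv_mul hβ, one_mul, ← mul_assoc, stepInv_mul hα, one_mul]
  obtain ⟨h1, h2, h3, -⟩ := three_inv_steps_entries a b c α β γ
  rw [hT]
  exact ⟨h1, h2, h3⟩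

/-! ### Spans of odd elements over the even part. -/

section EvenSpan

variable {K : Type u} [Field K] {R : Type v} [Ring R] [Algebra K R]
  (𝓡 : ZMod 2 → Submodule K R) [GradedAlgebra 𝓡]

/-- The combinations of a family of elements with even coefficients. -/
def evenSpan {ι : Type*} [Fintype ι] (θ : ι → R) : AddSubgroup R where
  carrier := {x | ∃ c : ι → 𝓡 0, x = ∑ i, (c i : R) * θ i}
  add_mem' := by
    rintro _ _ ⟨c, rfl⟩ ⟨d, rfl⟩
    exact ⟨c + d, by simp [add_mul, Finset.sum_add_distrib]⟩
  zero_mem' := ⟨0, by simp⟩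
  neg_mem' := by
    rintro _ ⟨c, rfl⟩
    exact ⟨-c, by simp⟩

theorem even_mul_mem_evenSpan {ι : Type*} [Fintype ι] {θ : ι → R} {x y : R} (hx : x ∈ 𝓡 0)
    (hy : y ∈ evenSpan 𝓡 θ) : x * y ∈ evenSpan 𝓡 θ := by
  obtain ⟨c, rfl⟩ := hy
  refine ⟨fun i => ⟨x * c i, even_mul_even 𝓡 hx (c i).2⟩, ?_⟩
  rw [Finset.mul_sum]
  exact Finset.sum_congr rfl fun i _ => (mul_assoc _ _ _).symm

theorem mem_evenSpan {ι : Type*} [Fintype ι] (θ : ι → R) (i : ι) : θ i ∈ evenSpan 𝓡 θ := by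
  classical
  refine ⟨Pi.single i ⟨1, even_one 𝓡⟩, ?_⟩
  rw [Finset.sum_eq_single i]
  · simp
  · intro j _ hj
    simp [hj]
  · simp

theorem evenSpan_le_odd {ι : Type*} [Fintype ι] {θ : ι → R} (hθ : ∀ i, θ i ∈ 𝓡 1) {x : R}
    (hx : x ∈ evenSpan 𝓡 θ) : x ∈ 𝓡 1 := by
  obtain ⟨c, rfl⟩ := hx
  exact sum_mem fun i _ => even_mul_odd 𝓡 (c i).2 (hθ i)

variable [IsSupercommutative 𝓡]

/-- The parities of the entries of a monodromy matrix; the odd entries are combinations of the odd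
coefficients. -/
theorem monodromy_mem {a β : ℤ → R} (N : AddSubgroup R) (hN : ∀ x ∈ N, x ∈ 𝓡 1)
    (hmul : ∀ x ∈ 𝓡 0, ∀ y ∈ N, x * y ∈ N) (ha : ∀ i, a i ∈ 𝓡 0) {i : ℤ} {k : ℕ}
    (hβ : ∀ l < k, β (i + l) ∈ N) :
    (∀ p q : Fin 2, monodromy a β i k p.castSucc q.castSucc ∈ 𝓡 0) ∧
      monodromy a β i k 2 2 ∈ 𝓡 0 ∧
      (∀ p : Fin 2, monodromy a β i k p.castSucc 2 ∈ N) ∧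
      ∀ q : Fin 2, monodromy a β i k 2 q.castSucc ∈ N := by
  induction k with
  | zero =>
    have h1 := even_one 𝓡
    simp [monodromy, Fin.forall_fin_two, h1]
  | succ k ih =>
    obtain ⟨h1, h2, h3, h4⟩ := ih fun l hl => hβ l (hl.trans k.lt_succ_self)
    have hb := hβ k k.lt_succ_self
    have hb' := hN _ hb
    have hak := ha (i + k)
    rw [Fin.forall_fin_two, Fin.forall_fin_two, Fin.forall_fin_two] at h1
    rw [Fin.forall_fin_two] at h3 h4
    have e0 : (Fin.castSucc 0 : Fin 3) = 0 := rfl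
    have e1 : (Fin.castSucc 1 : Fin 3) = 1 := rfl
    rw [e0, e1] at h1 h3 h4
    obtain ⟨⟨h00, h01⟩, h10, h11⟩ := h1
    obtain ⟨h02, h12⟩ := h3
    obtain ⟨h20, h21⟩ := h4
    have hbe : ∀ x ∈ 𝓡 0, β (i + k) * x ∈ N := fun x hx => by
      rw [← IsSupercommutative.even_comm (𝓡 := 𝓡) x hx]
      exact hmul x hx _ hb
    have hbo : ∀ x ∈ N, β (i + k) * x ∈ 𝓡 0 := fun x hx => odd_mul_odd 𝓡 hb' (hN x hx)
    simp only [monodromy, Fin.forall_fin_two, e0, e1, Matrix.mul_apply, Fin.sum_univ_three,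
      stepMatrix, Matrix.of_apply, Matrix.cons_val', Matrix.cons_val_zero, Matrix.cons_val_one,
      Matrix.cons_val, zero_mul, one_mul, zero_add, add_zero, neg_mul]
    refine ⟨⟨⟨h10, h11⟩, ?_, ?_⟩, ?_, ⟨h12, ?_⟩, ?_, ?_⟩
    · exact add_mem (add_mem (neg_mem h00) (even_mul_even 𝓡 hak h10)) (neg_mem (hbo _ h20))
    · exact add_mem (add_mem (neg_mem h01) (even_mul_even 𝓡 hak h11)) (neg_mem (hbo _ h21))
    · exact add_mem (hbo _ h12) h2
    · exact add_mem (add_mem (neg_mem h02) (hmul _ hak _ h12)) (neg_mem (hbe _ h2))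
    · exact add_mem (hbe _ h10) h20
    · exact add_mem (hbe _ h11) h21

theorem prod_ofFn_mul_of_even {a : R} (ha : a ∈ 𝓡 0) {s : ℕ} (y : Fin s → R) :
    (List.ofFn fun j => a * y j).prod = a ^ s * (List.ofFn y).prod := by
  induction s with
  | zero => simp
  | succ s ih =>
    rw [List.ofFn_succ, List.prod_cons, ih, List.ofFn_succ, List.prod_cons, pow_succ']
    have h := IsSupercommutative.even_comm (𝓡 := 𝓡) (a ^ s)
      (by simpa using SetLike.pow_mem_graded (A := 𝓡) s ha) (y 0)
    rw [mul_assoc, ← mul_assoc (y 0), ← h]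
    noncomm_ring

/-- For a Hill equation, multiplication by a coefficient `a_j` maps all `β_i` to the span of `n - 2`
odd elements. -/
theorem exists_odd_family_of_monodromy {k : ℕ} {a β : ℤ → R} (ha : ∀ i, a i ∈ 𝓡 0)
    (hβ : ∀ i, β i ∈ 𝓡 1) (i : ℤ) (hM : monodromy a β i (k + 3) = hillMonodromy R) :
    ∃ θ : Fin (k + 1) → R, (∀ l, θ l ∈ 𝓡 1) ∧
      ∀ l < k + 3, a (i + k + 1) * β (i + (l : ℕ)) ∈ evenSpan 𝓡 θ := by
  -- All `β` of the window except those of the steps on either side of the middle of the last three.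
  let θ : Fin (k + 1) → R := Fin.snoc (fun l : Fin k => β (i + (l : ℕ))) (β (i + k + 1))
  have hθ : ∀ l, θ l ∈ 𝓡 1 := by
    intro l
    induction l using Fin.lastCases with
    | last => simp only [θ, Fin.snoc_last]; exact hβ _
    | cast l => simp only [θ, Fin.snoc_castSucc]; exact hβ _
  have hlow : ∀ l < k, β (i + (l : ℕ)) ∈ evenSpan 𝓡 θ := by
    intro l hl
    have := mem_evenSpan 𝓡 θ (Fin.castSucc ⟨l, hl⟩)
    simpa only [θ, Fin.snoc_castSucc] using this
  have hlast : β (i + k + 1) ∈ evenSpan 𝓡 θ := by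
    have := mem_evenSpan 𝓡 θ (Fin.last k)
    simpa only [θ, Fin.snoc_last] using this
  obtain ⟨-, -, h3, h4⟩ := monodromy_mem 𝓡 (a := a) (evenSpan 𝓡 θ)
    (fun x hx => evenSpan_le_odd 𝓡 hθ hx) (fun x hx y hy => even_mul_mem_evenSpan 𝓡 hx hy) ha
    hlow
  have hsq : ∀ i, β i * β i = 0 := fun i => IsSupercommutative.odd_sq (𝓡 := 𝓡) _ (hβ i)
  simp only [monodromy] at hM
  push_cast at hM
  -- The odd entries of the first `k` steps lie in the span of `θ`, and they equal `-bγ - β` and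
  -- `-αb - β` with `b = a (i + k + 1)`. Hence `b` carries the two omitted coefficients `α` and `γ`
  -- into the span.
  obtain ⟨-, h12, h21⟩ := three_steps_entries (hsq _) (hsq _) (hsq _) hM
  have m12 := h3 1
  have m21 := h4 1
  have e1 : (Fin.castSucc 1 : Fin 3) = 1 := rfl
  rw [e1] at m12 m21
  rw [h12] at m12
  rw [h21] at m21
  have ea : i + (k + 1 : ℤ) = i + k + 1 := by ring
  rw [ea] at m12 m21
  refine ⟨θ, hθ, fun l hl => ?_⟩
  rcases lt_or_ge l k with h | h
  · exact even_mul_mem_evenSpan 𝓡 (ha _) (hlow l h)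
  · obtain rfl | rfl | rfl : l = k ∨ l = k + 1 ∨ l = k + 2 := by omega
    · have := neg_mem (add_mem m21 hlast)
      rw [IsSupercommutative.even_comm (𝓡 := 𝓡) _ (ha _)]
      simpa using this
    · have e : i + ((k + 1 : ℕ) : ℤ) = i + k + 1 := by push_cast; ring
      rw [e]
      exact even_mul_mem_evenSpan 𝓡 (ha _) hlast
    · have := neg_mem (add_mem m12 hlast)
      push_cast
      simpa using this

end EvenSpan

/-! ### Upper bounds for the even and odd dimensions of the space of Hill equations. -/

section HillUpper

variable (K : Type u) [Field K] (n : ℕ)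

theorem hillMk_surjective : Function.Surjective (hillMkGraded K n) :=
  superQuotMk_surjective _ _

/-- A field-valued point of the even part extends by zero to odd elements, which turns the Hill
condition into an `SL₂` product equal to `-1`. -/
theorem ringKrullDim_hill_le (hn : 3 ≤ n) : ringKrullDim (hillGrading K n 0) ≤ (n - 3 : ℕ) := by
  have : NeZero n := ⟨by omega⟩
  refine ringKrullDim_even_le (hillMkGraded K n) (hillMk_surjective K n) (n - 3)
    fun F _ _ g => ?_
  have hu := isHillEquation_universal (K := K) (n := n) (by omega)
  let G := evenExtend (hillGrading K n) g
  have hM := (isHillEquation_iff _ hu.1 0).1 hu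
  have h1 := map_monodromy G.toRingHom (fun i => hillMk K n (universalA K n i))
    (fun i => hillMk K n (universalB K n i)) 0 n
  have hz : (fun i => G.toRingHom (hillMk K n (universalB K n i))) = 0 :=
    funext fun i => evenExtend_odd _ g (hu.1 i).2.1
  rw [hz, hM, map_hillMonodromy] at h1
  let a' : ℕ → F := fun l => G (hillMk K n (universalA K n l))
  have h2 : slMonodromy a' n = Matrix.diagonal fun _ => (-1 : F) := by
    ext p q
    have h3 := monodromy_zero_eq_slMonodromy
      (fun i => G.toRingHom (hillMk K n (universalA K n i))) 0 n p q
    rw [← h1] at h3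
    simp only [zero_add] at h3
    refine h3.symm.trans ?_
    fin_cases p <;> fin_cases q <;> simp [hillMonodromy]
  obtain ⟨s, hs, hmem⟩ := exists_adjoin_of_slMonodromy (K := K) n (by omega) a' (-1) (by simp) h2
  refine ⟨s, hs, fun i => ?_⟩
  have h4 := hmem i.val (ZMod.val_lt i)
  have h5 : a' i.val = g (evenMap (hillMkGraded K n)
      (potentialCoord K n (MvPolynomial.X ((i.val : ℤ) : ZMod n)))) :=
    evenExtend_even (hillGrading K n) g (evenMap (hillMkGraded K n)
      (potentialCoord K n (MvPolynomial.X ((i.val : ℤ) : ZMod n))))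
  have h6 : ((i.val : ℤ) : ZMod n) = i := by simp
  rw [h6] at h5
  rwa [h5] at h4

/-- Powers of the even coordinates annihilate all products of more than `n - 2` odd elements. -/
theorem universalA_pow_mul_prod_eq_zero (hn : 3 ≤ n) {s : ℕ} (hs : n - 2 < s)
    (y : Fin s → HillAlgebra K n) (hy : ∀ j, y j ∈ hillGrading K n 1) (j : ℤ) :
    hillMk K n (universalA K n j) ^ s * (List.ofFn y).prod = 0 := by
  obtain ⟨k, rfl⟩ : ∃ k, n = k + 3 := ⟨n - 3, by omega⟩
  have hu := isHillEquation_universal (K := K) (n := k + 3) (by omega)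
  set a : ℤ → HillAlgebra K (k + 3) := fun i => hillMk K (k + 3) (universalA K (k + 3) i) with ha
  set β : ℤ → HillAlgebra K (k + 3) := fun i => hillMk K (k + 3) (universalB K (k + 3) i) with hβ
  -- The window starts so that `j` is the middle of its last three steps.
  let i : ℤ := j - k - 1
  obtain ⟨θ, hθ, hmem⟩ := exists_odd_family_of_monodromy (hillGrading K (k + 3)) (k := k)
    (fun i => (hu.1 i).1) (fun i => (hu.1 i).2.1) i ((isHillEquation_iff _ hu.1 i).1 hu)
  have hij : i + k + 1 = j := by simp only [i]; ring
  rw [hij] at hmem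
  have haj : a j ∈ hillGrading K (k + 3) 0 := (hu.1 j).1
  have hcoord : ∀ m : ZMod (k + 3),
      a j * hillMkGraded K (k + 3) (oddCoord K (k + 3) m) ∈ evenSpan (hillGrading K (k + 3)) θ := by
    intro m
    obtain ⟨l, hl, hlm⟩ : ∃ l < k + 3, ((i + (l : ℕ) : ℤ) : ZMod (k + 3)) = m :=
      ⟨(m - (i : ZMod (k + 3))).val, ZMod.val_lt _, by simp⟩
    have h1 := hmem l hl
    have h2 : β (i + l) = (Int.negOnePow ((i + l) / (k + 3 : ℕ)) : ℤ) •
        hillMkGraded K (k + 3) (oddCoord K (k + 3) m) := by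
      simp only [hβ, universalB, hlm]
      exact map_zsmul (hillMk K (k + 3)) _ _
    rw [h2] at h1
    rcases Int.units_eq_one_or ((i + l) / (k + 3 : ℕ) : ℤ).negOnePow with hu | hu
    · rwa [hu, Units.val_one, one_smul] at h1
    · rwa [hu, Units.val_neg, Units.val_one, neg_smul, one_smul, mul_neg, neg_mem_iff] at h1
  have hyN : ∀ t, a j * y t ∈ evenSpan (hillGrading K (k + 3)) θ := by
    intro t
    obtain ⟨c, hc⟩ := exists_eq_sum_mul_oddCoord (hillMkGraded K (k + 3))
      (hillMk_surjective K (k + 3)) (hy t)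
    rw [hc, Finset.mul_sum]
    refine sum_mem fun m _ => ?_
    rw [← mul_assoc, IsSupercommutative.even_comm (𝓡 := hillGrading K (k + 3)) _ haj, mul_assoc]
    exact even_mul_mem_evenSpan _ (c m).2 (hcoord m)
  choose c hc using hyN
  have := prod_odd_eq_zero (hillGrading K (k + 3)) θ hθ (s := s)
    (by rw [Fintype.card_fin]; omega) (fun t => a j * y t) c hc
  rwa [prod_ofFn_mul_of_even (hillGrading K (k + 3)) haj] at this

/-- Modulo the annihilator every even coordinate is nilpotent, so the dimension is at most `0`, too
small once `n > 3`. For `n = 3` the partial monodromy is the identity, which forces the coefficient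
to be `1`; then the product is zero and the quotient trivial. -/
theorem ringKrullDim_hill_quotient_ne (hn : 3 ≤ n) {s : ℕ} (hs : n - 2 < s)
    (y : Fin s → HillAlgebra K n) (hy : ∀ j, y j ∈ hillGrading K n 1) :
    ringKrullDim (hillGrading K n 0 ⧸ evenAnnihilator (hillGrading K n) (List.ofFn y).prod) ≠
      (n - 3 : ℕ) := by
  have : NeZero n := ⟨by omega⟩
  have hpow := universalA_pow_mul_prod_eq_zero K n hn hs y hy
  rcases hn.eq_or_lt with rfl | hn'
  · rw [ringKrullDim_quotient_eq_bot]
    · exact WithBot.bot_ne_coe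
    · have hu := isHillEquation_universal (K := K) (n := 3) (by omega)
      have hM := (isHillEquation_iff _ hu.1 0).1 hu
      have hsq := fun i => IsSupercommutative.odd_sq (𝓡 := hillGrading K 3) _ (hu.1 i).2.1
      have h1 := (three_steps_entries (hsq _) (hsq _) (hsq _) hM).1
      have h2 := hpow (0 + (0 + 1 : ℕ))
      have h3 : hillMk K 3 (universalA K 3 (0 + (0 + 1 : ℕ))) = 1 :=
        h1.symm.trans (by simp [monodromy])
      rw [h3, one_pow] at h2
      exact h2
  · have hle : ringKrullDim (hillGrading K n 0 ⧸
        evenAnnihilator (hillGrading K n) (List.ofFn y).prod) ≤ (0 : ℕ) := by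
      refine ringKrullDim_even_quotient_le (hillMkGraded K n) (hillMk_surjective K n) _ 0
        fun F _ _ g hg => ⟨∅, le_rfl, fun i => ?_⟩
      obtain ⟨j, rfl⟩ := ZMod.intCast_surjective i
      have h1 := hg (evenMap (hillMkGraded K n)
        (potentialCoord K n (MvPolynomial.X (j : ZMod n))) ^ s) (hpow j)
      rw [map_pow] at h1
      rw [eq_zero_of_pow_eq_zero h1]
      exact zero_mem _
    intro h
    rw [h] at hle
    have : n - 3 ≤ 0 := by exact_mod_cast hle
    omega

end HillUpper

/-! ## The supergroup `OSp(1|2)` -/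

section OSp

variable {S R : Type*} [CommRing S] [Ring R] [Algebra S R]

/-- These are the determinant relation, the corner entry and the new third-column entry for a step
times an `OSp(1|2)` matrix; `w₁` and `w₂` name the even products `ηα` and `ηβ`. Cubic odd terms are
removed by multiplying the determinant relation by `η`. -/
theorem osp_step_identities (a b c d p w₁ w₂ : S) (α β η : R)
    (hη : η * η = 0) (hαη : α * η = -(η * α))
    (hβη : β * η = -(η * β)) (hβα : β * α = -(α * β))
    (h : (a * d - b * c) • (1 : R) = 1 - α * β) (hw₁ : w₁ • (1 : R) = η * α)
    (hw₂ : w₂ • (1 : R) = η * β) :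
    ((c * (-b + p * d - w₂) - d * (-a + p * c - w₁)) • (1 : R) =
      1 - (c • η + α) * (d • η + β)) ∧
    (η * (c • β - d • α) + (1 + α * β) = 1 + (c • η + α) * (d • η + β)) ∧
    (-(a • β - b • α) + p • (c • β - d • α) - η * (1 + α * β) =
      (-a + p * c - w₁) • (d • η + β) - (-b + p * d - w₂) • (c • η + α)) := by
  have e1 : ∀ x : R, w₁ • x = η * (α * x) := fun x => by
    rw [← one_mul x, ← smul_mul_assoc, hw₁, one_mul, mul_assoc]
  have e2 : ∀ x : R, w₂ • x = η * (β * x) := fun x => by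
    rw [← one_mul x, ← smul_mul_assoc, hw₂, one_mul, mul_assoc]
  have hη' : η * (η * α) = 0 := by rw [← mul_assoc, hη, zero_mul]
  have hη'' : η * (η * β) = 0 := by rw [← mul_assoc, hη, zero_mul]
  have hs : η * (α * β) = (a * d - b * c) • (-η) + η := by
    have := congrArg (η * ·) h
    simp only [mul_smul_comm, mul_one, mul_sub] at this
    linear_combination (norm := module) this
  refine ⟨?_, ?_, ?_⟩
  · simp only [add_mul, mul_add, smul_mul_assoc, mul_smul_comm, hη, hαη]
    linear_combination (norm := module) h + d • hw₁ - c • hw₂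
  · simp only [add_mul, mul_add, mul_sub, smul_mul_assoc, mul_smul_comm, hη, hαη]
    module
  · simp only [sub_smul, add_smul, neg_smul, e1, e2, mul_add, mul_smul_comm, hαη, hβη, hβα, mul_one,
      mul_neg, hη', hη'', hs, smul_add, smul_sub]
    module
-- The analogue for inverse steps, whose nontrivial new row is the first one.
theorem osp_inv_step_identities (a b c d p w₁ w₂ : S) (α β η : R)
    (hη : η * η = 0) (hαη : α * η = -(η * α))
    (hβη : β * η = -(η * β)) (hβα : β * α = -(α * β))
    (h : (a * d - b * c) • (1 : R) = 1 - α * β) (hw₁ : w₁ • (1 : R) = η * α)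
    (hw₂ : w₂ • (1 : R) = η * β) :
    (((p * a - c - w₁) * b - (p * b - d - w₂) * a) • (1 : R) =
      1 - (α - a • η) * (β - b • η)) ∧
    ((1 + α * β) - η * (a • β - b • α) = 1 + (α - a • η) * (β - b • η)) ∧
    (p • (a • β - b • α) - (c • β - d • α) - η * (1 + α * β) =
      (p * a - c - w₁) • (β - b • η) - (p * b - d - w₂) • (α - a • η)) := by
  have e1 : ∀ x : R, w₁ • x = η * (α * x) := fun x => by
    rw [← one_mul x, ← smul_mul_assoc, hw₁, one_mul, mul_assoc]
  have e2 : ∀ x : R, w₂ • x = η * (β * x) := fun x => by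
    rw [← one_mul x, ← smul_mul_assoc, hw₂, one_mul, mul_assoc]
  have hη' : η * (η * α) = 0 := by rw [← mul_assoc, hη, zero_mul]
  have hη'' : η * (η * β) = 0 := by rw [← mul_assoc, hη, zero_mul]
  have hs : η * (α * β) = (a * d - b * c) • (-η) + η := by
    have := congrArg (η * ·) h
    simp only [mul_smul_comm, mul_one, mul_sub] at this
    linear_combination (norm := module) this
  refine ⟨?_, ?_, ?_⟩
  · simp only [sub_mul, mul_sub, smul_mul_assoc, mul_smul_comm, hη, hαη]
    linear_combination (norm := module) h - b • hw₁ + a • hw₂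
  · simp only [sub_mul, mul_sub, smul_mul_assoc, mul_smul_comm, hη, hαη]
    module
  · simp only [sub_smul, e1, e2, mul_add, mul_smul_comm, hαη, hβη, hβα, mul_one,
      mul_neg, hη', hη'', hs, smul_sub]
    module
/-- A submodule behaving like the odd part of a supercommutative algebra with even part `S`. -/
structure IsOddSubmodule (N : Submodule S R) : Prop where
  anticomm : ∀ x ∈ N, ∀ y ∈ N, x * y = -(y * x)
  sq : ∀ x ∈ N, x * x = 0
  mul : ∀ x ∈ N, ∀ y ∈ N, ∃ w : S, w • (1 : R) = x * y

/-- The matrices of the supergroup `OSp(1|2)`. -/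
def IsOSp (N : Submodule S R) (T : Matrix (Fin 3) (Fin 3) R) : Prop :=
  ∃ (a b c d : S) (α β : R), α ∈ N ∧ β ∈ N ∧ (a * d - b * c) • (1 : R) = 1 - α * β ∧
    T = !![a • (1 : R), b • (1 : R), a • β - b • α;
           c • (1 : R), d • (1 : R), c • β - d • α;
           α, β, 1 + α * β]

variable {N : Submodule S R}

theorem isOSp_one : IsOSp N (1 : Matrix (Fin 3) (Fin 3) R) := by
  refine ⟨1, 0, 0, 1, 0, 0, zero_mem _, zero_mem _, by simp, ?_⟩
  ext i j
  fin_cases i <;> fin_cases j <;> simp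

theorem isOSp_hillMonodromy : IsOSp N (hillMonodromy R) := by
  refine ⟨-1, 0, 0, -1, 0, 0, zero_mem _, zero_mem _, by simp, ?_⟩
  ext i j
  fin_cases i <;> fin_cases j <;> simp [hillMonodromy]

theorem IsOSp.stepMatrix_mul (hN : IsOddSubmodule N) {T : Matrix (Fin 3) (Fin 3) R}
    (hT : IsOSp N T) (p : S) {η : R} (hη : η ∈ N) :
    IsOSp N (stepMatrix (p • (1 : R)) η * T) := by
  obtain ⟨a, b, c, d, α, β, hα, hβ, h, rfl⟩ := hT
  obtain ⟨w₁, hw₁⟩ := hN.mul η hη α hα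
  obtain ⟨w₂, hw₂⟩ := hN.mul η hη β hβ
  obtain ⟨h1, h2, h3⟩ := osp_step_identities a b c d p w₁ w₂ α β η (hN.sq η hη)
    (hN.anticomm α hα η hη) (hN.anticomm β hβ η hη) (hN.anticomm β hβ α hα) h hw₁ hw₂
  refine ⟨c, d, -a + p * c - w₁, -b + p * d - w₂, c • η + α, d • η + β,
    add_mem (N.smul_mem _ hη) hα, add_mem (N.smul_mem _ hη) hβ, h1, ?_⟩
  rw [← h2, ← h3]
  ext i j
  fin_cases i <;> fin_cases j <;>
    simp [stepMatrix, Matrix.mul_apply, Fin.sum_univ_three, hw₁, hw₂, add_smul, sub_smul, mul_smul]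
  all_goals module

theorem IsOSp.stepInv_mul (hN : IsOddSubmodule N) {T : Matrix (Fin 3) (Fin 3) R}
    (hT : IsOSp N T) (p : S) {η : R} (hη : η ∈ N) :
    IsOSp N (stepInv (p • (1 : R)) η * T) := by
  obtain ⟨a, b, c, d, α, β, hα, hβ, h, rfl⟩ := hT
  obtain ⟨w₁, hw₁⟩ := hN.mul η hη α hα
  obtain ⟨w₂, hw₂⟩ := hN.mul η hη β hβ
  obtain ⟨h1, h2, h3⟩ := osp_inv_step_identities a b c d p w₁ w₂ α β η (hN.sq η hη)
    (hN.anticomm α hα η hη) (hN.anticomm β hβ η hη) (hN.anticomm β hβ α hα) h hw₁ hw₂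
  refine ⟨p * a - c - w₁, p * b - d - w₂, a, b, α - a • η, β - b • η,
    sub_mem hα (N.smul_mem _ hη), sub_mem hβ (N.smul_mem _ hη), h1, ?_⟩
  rw [← h2, ← h3]
  ext i j
  fin_cases i <;> fin_cases j <;>
    simp [stepInv, Matrix.mul_apply, Fin.sum_univ_three, hw₁, hw₂, sub_smul, mul_smul]
  all_goals module

/-- An element of `OSp(1|2)` is determined by its middle row and column, if their common entry is
invertible. -/
theorem IsOSp.eq_of_middle (hinj : ∀ s t : S, s • (1 : R) = t • (1 : R) → s = t)
    {T T' : Matrix (Fin 3) (Fin 3) R} (hT : IsOSp N T) (hT' : IsOSp N T') {d : S} (hd : IsUnit d)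
    (h11 : T 1 1 = d • (1 : R)) (h11' : T' 1 1 = d • (1 : R)) (h10 : T 1 0 = T' 1 0)
    (h12 : T 1 2 = T' 1 2) (h01 : T 0 1 = T' 0 1) (h21 : T 2 1 = T' 2 1) : T = T' := by
  obtain ⟨a, b, c, d₁, α, β, hα, hβ, h, rfl⟩ := hT
  obtain ⟨a', b', c', d₂, α', β', hα', hβ', h', rfl⟩ := hT'
  obtain rfl : d₁ = d := hinj _ _ h11
  obtain rfl : d₂ = d₁ := hinj _ _ h11'
  obtain rfl : c = c' := hinj _ _ h10
  obtain rfl : b = b' := hinj _ _ h01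
  obtain rfl : β = β' := h21
  -- Invertibility of the middle entry recovers `α` from the third column, and then the corner `a`
  -- from the determinant relation.
  have h12' : c • β - d₂ • α = c • β - d₂ • α' := h12
  obtain rfl : α = α' := hd.smul_left_cancel.1 (sub_right_injective h12')
  have ha : a * d₂ = a' * d₂ := by
    have := hinj _ _ (h.trans h'.symm)
    linear_combination this
  obtain rfl : a = a' := hd.mul_right_cancel ha
  rfl

/-- Given a partial monodromy matrix, the last three steps can be chosen so that the monodromy
is `diag(-1, -1, 1)`; the middle odd coefficient is arbitrary. -/
theorem IsOSp.exists_three_steps (hN : IsOddSubmodule N)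
    (hinj : ∀ s t : S, s • (1 : R) = t • (1 : R) → s = t)
    {T : Matrix (Fin 3) (Fin 3) R} (hT : IsOSp N T) {d : S} (hd : IsUnit d)
    (h11 : T 1 1 = d • (1 : R)) {θ : R} (hθ : θ ∈ N) :
    ∃ (a c : S) (α γ : R), α ∈ N ∧ γ ∈ N ∧
      stepMatrix (c • (1 : R)) γ * (stepMatrix (d • (1 : R)) θ * (stepMatrix (a • (1 : R)) α * T)) =
        hillMonodromy R := by
  obtain ⟨u, hu⟩ := hd.exists_left_inv
  have huR : ∀ x : R, (d • (1 : R)) * (u • x) = x := fun x => by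
    rw [smul_mul_assoc, one_mul, smul_smul, mul_comm, hu, one_smul]
  have huR' : ∀ x : R, (u • x) * (d • (1 : R)) = x := fun x => by
    rw [mul_smul_comm, mul_one, smul_smul, mul_comm, hu, one_smul]
  have hT' := hT
  obtain ⟨t00, t01, t10, t11, t20, t21, h20, h21, hdet, hTe⟩ := hT
  have e12 : T 1 2 = t10 • t21 - t11 • t20 := by rw [hTe]; rfl
  have e21 : T 2 1 = t21 := by rw [hTe]; rfl
  have e10 : T 1 0 = t10 • (1 : R) := by rw [hTe]; rfl
  have e01 : T 0 1 = t01 • (1 : R) := by rw [hTe]; rfl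
  have m12 : T 1 2 ∈ N := e12 ▸ sub_mem (N.smul_mem _ h21) (N.smul_mem _ h20)
  have m21 : T 2 1 ∈ N := e21 ▸ h21
  -- With middle coefficient `d`, the odd entries `T 2 1` and `T 1 2` are solved for `α` and `γ`.
  -- Then `T 0 1` and `T 1 0` give `a` and `c`, corrected by the even products `w = αθ` and `w' =
  -- θγ`.
  let α : R := u • (-(T 2 1) - θ)
  let γ : R := u • (-(T 1 2) - θ)
  have hα : α ∈ N := N.smul_mem _ (sub_mem (neg_mem m21) hθ)
  have hγ : γ ∈ N := N.smul_mem _ (sub_mem (neg_mem m12) hθ)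
  obtain ⟨w, hw⟩ := hN.mul α hα θ hθ
  obtain ⟨w', hw'⟩ := hN.mul θ hθ γ hγ
  let a : S := u * (t01 + 1 - w)
  let c : S := u * (1 - t10 - w')
  refine ⟨a, c, α, γ, hα, hγ, ?_⟩
  have hosp := ((isOSp_hillMonodromy.stepInv_mul hN c hγ).stepInv_mul hN d hθ).stepInv_mul hN a hα
  obtain ⟨g11, g12, g21, g10, g01⟩ :=
    three_inv_steps_entries (a • (1 : R)) (d • (1 : R)) (c • (1 : R)) α θ γ
  have key := hT'.eq_of_middle hinj hosp hd h11 g11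
    (by
      rw [g10, e10, ← hw']
      simp only [c, mul_smul, huR, sub_smul, one_smul]
      abel)
    (by
      rw [g12]
      simp only [γ, huR]
      abel)
    (by
      rw [g01, e01, ← hw]
      simp only [a, mul_smul, huR', sub_smul, add_smul, one_smul]
      abel)
    (by
      rw [g21]
      simp only [α, huR']
      abel)
  rw [key, ← mul_assoc (stepMatrix (a • (1 : R)) α), mul_stepInv (hN.sq _ hα), one_mul,
    ← mul_assoc (stepMatrix (d • (1 : R)) θ), mul_stepInv (hN.sq _ hθ), one_mul, ← mul_assoc,
    mul_stepInv (hN.sq _ hγ), one_mul]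

end OSp

/-! ## A point of the space of Hill equations in general position -/

section Completion

theorem monodromy_congr {R : Type*} [Ring R] {a β a' β' : ℤ → R} {i : ℤ} {k : ℕ}
    (h : ∀ l < k, a (i + (l : ℕ)) = a' (i + (l : ℕ)) ∧ β (i + (l : ℕ)) = β' (i + (l : ℕ))) :
    monodromy a β i k = monodromy a' β' i k := by
  induction k with
  | zero => rfl
  | succ k ih =>
    rw [monodromy, monodromy, ih fun l hl => h l (hl.trans k.lt_succ_self),
      (h k k.lt_succ_self).1, (h k k.lt_succ_self).2]

variable {K : Type u} [Field K] {R : Type v} [Ring R] [Algebra K R]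
  (𝓡 : ZMod 2 → Submodule K R) [GradedAlgebra 𝓡] [IsSupercommutative 𝓡]

/-- The even component of an inverse is already an inverse. -/
theorem isUnit_even_of_isUnit {x : 𝓡 0} (h : IsUnit (x : R)) : IsUnit x := by
  obtain ⟨u, hu⟩ := h.exists_right_inv
  have h1 := zmod_two_decompose_add 𝓡 u
  set u0 := decompose 𝓡 u 0
  set u1 := decompose 𝓡 u 1
  have h2 : (x : R) * u0 + x * u1 = 1 + 0 := by rw [← mul_add, h1, hu, add_zero]
  have h3 := even_odd_unique 𝓡 (even_mul_even 𝓡 x.2 u0.2) (even_one 𝓡) (even_mul_odd 𝓡 x.2 u1.2)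
    (zero_mem _) h2
  exact IsUnit.of_mul_eq_one u0 (Subtype.ext h3.1)

/-- Prescribed coefficients `a_l`, `β_l` for `l < k` and `β_{k+1}` extend to a Hill equation of
period `k + 3`, if the middle entry of the partial monodromy matrix is invertible. -/
theorem exists_isHillEquation_extending {k : ℕ} {a b : ℕ → R} (ha : ∀ l, a l ∈ 𝓡 0)
    (hb : ∀ l, b l ∈ 𝓡 1) {θ : R} (hθ : θ ∈ 𝓡 1) {d : 𝓡 0} (hd : IsUnit d)
    (hT : monodromy (fun i => a i.toNat) (fun i => b i.toNat) 0 k 1 1 = d) :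
    ∃ A B : ℤ → R, IsHillEquation 𝓡 (k + 3) A B ∧ (∀ l < k, A (l : ℕ) = a l) ∧
      (∀ l < k, B (l : ℕ) = b l) ∧ B ((k + 1 : ℕ) : ℤ) = θ := by
  let : Algebra (𝓡 0) R := RingHom.toAlgebra' (evenSubtype 𝓡).toRingHom fun a x =>
    IsSupercommutative.even_comm (𝓡 := 𝓡) a a.2 x
  have hsmul : ∀ s : 𝓡 0, s • (1 : R) = s := fun s => (Algebra.smul_def s 1).trans (mul_one _)
  let N : Submodule (𝓡 0) R :=
    { carrier := {x | x ∈ 𝓡 1}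
      add_mem' := fun hx hy => add_mem (S := Submodule K R) hx hy
      zero_mem' := zero_mem (𝓡 1)
      smul_mem' := fun c x hx => (Algebra.smul_def c x).symm ▸ even_mul_odd 𝓡 c.2 hx }
  have hN : IsOddSubmodule N :=
    { anticomm := fun x hx y hy => IsSupercommutative.odd_anticomm (𝓡 := 𝓡) x hx y hy
      sq := fun x hx => IsSupercommutative.odd_sq (𝓡 := 𝓡) x hx
      mul := fun x hx y hy => ⟨⟨x * y, odd_mul_odd 𝓡 hx hy⟩, hsmul _⟩ }
  have hosp : ∀ k, IsOSp N (monodromy (fun i => a i.toNat) (fun i => b i.toNat) 0 k) := by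
    intro k
    induction k with
    | zero => exact isOSp_one
    | succ k ih =>
      have := ih.stepMatrix_mul hN ⟨a (0 + (k : ℤ)).toNat, ha _⟩ (hb (0 + (k : ℤ)).toNat)
      rwa [hsmul] at this
  obtain ⟨a₀, c, α, γ, hα, hγ, hM⟩ := (hosp k).exists_three_steps hN
    (fun s t hst => Subtype.ext ((hsmul s).symm.trans (hst.trans (hsmul t)))) hd
    (hT.trans (hsmul d).symm) hθ
  rw [hsmul, hsmul, hsmul] at hM
  -- The solved steps occupy positions `k`, `k + 1`, `k + 2`; the even coefficient at `k + 1` must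
  -- be the middle entry `d`.
  let a' : ℕ → R := fun l => if l < k then a l else if l = k then a₀ else if l = k + 1 then d else c
  let b' : ℕ → R := fun l => if l < k then b l else if l = k then α else if l = k + 1 then θ else γ
  have ha' : ∀ l, a' l ∈ 𝓡 0 := fun l => by
    simp only [a']
    split_ifs
    exacts [ha l, a₀.2, d.2, c.2]
  have hb' : ∀ l, b' l ∈ 𝓡 1 := fun l => by
    simp only [b']
    split_ifs
    exacts [hb l, hα, hθ, hγ]
  have hp := isPotential_periodicExt 𝓡 (n := k + 3) (by omega) ha' hb'
  have hA : ∀ l < k + 3, periodicExt (k + 3) a' (l : ℕ) = a' l := fun l hl =>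
    periodicExt_natCast hl a'
  have hB : ∀ l < k + 3, antiperiodicExt (k + 3) b' (l : ℕ) = b' l := fun l hl =>
    antiperiodicExt_natCast hl b'
  refine ⟨periodicExt (k + 3) a', antiperiodicExt (k + 3) b', ?_, fun l hl => ?_, fun l hl => ?_,
    ?_⟩
  · rw [isHillEquation_iff 𝓡 hp 0, ← hM]
    have hlow : monodromy (periodicExt (k + 3) a') (antiperiodicExt (k + 3) b') 0 k =
        monodromy (fun i => a i.toNat) (fun i => b i.toNat) 0 k := by
      refine monodromy_congr fun l hl => ?_
      rw [zero_add, hA l (by omega), hB l (by omega)]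
      simp [a', b', hl]
    simp only [monodromy, hlow, zero_add]
    rw [hA k (by omega), hB k (by omega), hA (k + 1) (by omega), hB (k + 1) (by omega),
      hA (k + 2) (by omega), hB (k + 2) (by omega)]
    simp [a', b']
  · rw [hA l (by omega)]; simp [a', hl]
  · rw [hB l (by omega)]; simp [b', hl]
  · rw [hB (k + 1) (by omega)]; simp [b']

end Completion

/-! ### Nonvanishing of the generic continuant. -/

theorem map_slMonodromy {R R' : Type*} [Ring R] [Ring R'] (φ : R →+* R') (a : ℕ → R) (k : ℕ) :
    (slMonodromy a k).map φ = slMonodromy (fun l => φ (a l)) k := by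
  induction k with
  | zero => simp [slMonodromy]
  | succ k ih =>
    rw [slMonodromy, Matrix.map_mul, ih, slMonodromy]
    congr 1
    ext p q
    fin_cases p <;> fin_cases q <;> simp [slStep]

/-- After the first step both entries of the last column are `1`, and a step with coefficient `0`
only swaps them up to sign. -/
theorem slMonodromy_single_ne_zero (F : Type*) [Field F] (k : ℕ) :
    slMonodromy (fun l => if l = 0 then (1 : F) else 0) k 1 1 ≠ 0 := by
  rcases Nat.eq_zero_or_pos k with rfl | hk
  · simp [slMonodromy]
  have : slMonodromy (fun l => if l = 0 then (1 : F) else 0) k 0 1 ≠ 0 ∧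
      slMonodromy (fun l => if l = 0 then (1 : F) else 0) k 1 1 ≠ 0 := by
    induction k, hk using Nat.le_induction with
    | base => simp [slMonodromy, slStep]
    | succ k hk ih =>
      have h0 : k ≠ 0 := by omega
      simp only [slMonodromy, slStep, Matrix.mul_apply, Fin.sum_univ_two, if_neg h0]
      simpa using ih.symm
  exact this.2

/-- The continuant of independent variables does not vanish. -/
theorem slMonodromy_X_ne_zero (K : Type*) [Field K] (k : ℕ) :
    slMonodromy (fun l => if h : l < k then (MvPolynomial.X ⟨l, h⟩ : MvPolynomial (Fin k) K) else 0)
      k 1 1 ≠ 0 := by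
  intro h
  -- Specialization of the variables to `(1, 0, …, 0)`.
  have h1 := congrArg (MvPolynomial.aeval fun l : Fin k => if (l : ℕ) = 0 then (1 : K) else 0) h
  rw [map_zero] at h1
  have h2 := map_slMonodromy (MvPolynomial.aeval
    fun l : Fin k => if (l : ℕ) = 0 then (1 : K) else 0).toRingHom
    (fun l => if h : l < k then (MvPolynomial.X ⟨l, h⟩ : MvPolynomial (Fin k) K) else 0) k
  have h3 := (congrFun (congrFun h2 1) 1).symm.trans h1
  refine slMonodromy_single_ne_zero K k (Eq.trans ?_ h3)
  refine congrFun (congrFun (slMonodromy_congr fun l hl => ?_) 1) 1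
  rw [dif_pos hl]
  simp

theorem algebraMapInv_ι {P M : Type*} [CommRing P] [AddCommGroup M] [Module P M] (m : M) :
    ExteriorAlgebra.algebraMapInv (ExteriorAlgebra.ι P m) = 0 := by
  rw [ExteriorAlgebra.algebraMapInv, ExteriorAlgebra.lift_ι_apply]
  rfl

/-! ### The generic point and the superdimension of the space of Hill equations. -/

section HillLower

variable (K : Type u) [Field K]

/-- The odd parameters are `β_0, …, β_{k-1}` and `β_{k+1}`, the ones that stay free when the last
three steps are solved for. At the generic point they become the exterior generators, while `a_0, …,
a_{k-1}` become independent variables. -/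
theorem exists_le_ringKrullDim_hill_quotient (k : ℕ) :
    ∃ y : Fin (k + 1) → HillAlgebra K (k + 3), (∀ i, y i ∈ hillGrading K (k + 3) 1) ∧
      (k : WithBot ℕ∞) ≤ ringKrullDim (hillGrading K (k + 3) 0 ⧸
        evenAnnihilator (hillGrading K (k + 3)) (List.ofFn y).prod) := by
  let L := FractionRing (MvPolynomial (Fin k) K)
  let x' : Fin k → L := fun i => algebraMap (MvPolynomial (Fin k) K) L (MvPolynomial.X i)
  let M := Fin (k + 1) → L
  let Λ := ExteriorAlgebra L M
  let a : ℕ → Λ := fun l => if h : l < k then algebraMap L Λ (x' ⟨l, h⟩) else 0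
  let b : ℕ → Λ := fun l =>
    if h : l < k then ExteriorAlgebra.ι L (Pi.single ⟨l, h.trans k.lt_succ_self⟩ 1) else 0
  let θ : Λ := ExteriorAlgebra.ι L (Pi.single (Fin.last k) 1)
  have ha : ∀ l, a l ∈ exteriorGrading K L M 0 := fun l => by
    by_cases h : l < k
    · simp only [a, dif_pos h]
      exact (SetLike.algebraMap_mem_graded (CliffordAlgebra.evenOdd (0 : QuadraticForm L M)) _ :)
    · simp only [a, dif_neg h]; exact zero_mem _
  have hb : ∀ l, b l ∈ exteriorGrading K L M 1 := fun l => by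
    by_cases h : l < k
    · simp only [b, dif_pos h]
      exact ι_mem_odd _
    · simp only [b, dif_neg h]; exact zero_mem _
  have hTmem : monodromy (fun i => a i.toNat) (fun i => b i.toNat) 0 k 1 1 ∈
      exteriorGrading K L M 0 :=
    (monodromy_mem (exteriorGrading K L M) (exteriorGrading K L M 1).toAddSubgroup
      (fun x hx => hx) (fun x hx y hy => even_mul_odd (exteriorGrading K L M) hx hy)
      (fun i => ha _) (fun l _ => hb _)).1 1 1
  let d : exteriorGrading K L M 0 := ⟨_, hTmem⟩
  -- Setting the exterior generators to zero leaves the continuant of the independent variables, so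
  -- `d` has nonzero scalar part and is a unit.
  have hinv : ExteriorAlgebra.algebraMapInv (d : Λ) ≠ 0 := by
    let φ : Λ →ₐ[L] L := ExteriorAlgebra.algebraMapInv
    have h1 := map_monodromy φ.toRingHom (fun i => a i.toNat) (fun i => b i.toNat) 0 k
    have hz : (fun i : ℤ => φ.toRingHom (b i.toNat)) = 0 := by
      funext i
      have hι : ∀ m, φ (ExteriorAlgebra.ι L m) = 0 := fun m => algebraMapInv_ι m
      change φ (b i.toNat) = 0
      by_cases h : i.toNat < k
      · exact (congrArg φ (dif_pos h)).trans (hι _)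
      · exact (congrArg φ (dif_neg h)).trans (map_zero φ)
    rw [hz] at h1
    have h2 := (congrFun (congrFun h1 1) 1).trans
      (monodromy_zero_eq_slMonodromy (fun i : ℤ => φ.toRingHom (a i.toNat)) 0 k 1 1)
    have h3 := map_slMonodromy (algebraMap (MvPolynomial (Fin k) K) L)
      (fun l => if h : l < k then (MvPolynomial.X ⟨l, h⟩ : MvPolynomial (Fin k) K) else 0) k
    intro h
    refine slMonodromy_X_ne_zero K k (IsFractionRing.injective (MvPolynomial (Fin k) K) L ?_)
    rw [map_zero]
    refine (congrFun (congrFun h3 1) 1).trans (Eq.trans ?_ (h2.symm.trans h))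
    refine congrFun (congrFun (slMonodromy_congr fun l hl => ?_) 1) 1
    change _ = φ (a (0 + (l : ℤ)).toNat)
    rw [zero_add, Int.toNat_natCast]
    simp only [a, dif_pos hl]
    exact (ExteriorAlgebra.algebraMap_leftInverse M _).symm
  have hd : IsUnit d := isUnit_even_of_isUnit (exteriorGrading K L M)
    (isUnit_of_algebraMapInv_ne_zero _ hTmem hinv)
  obtain ⟨A, B, hAB, hA, hB, hBθ⟩ :=
    exists_isHillEquation_extending (exteriorGrading K L M) ha hb (θ := θ) (ι_mem_odd _) hd rfl
  obtain ⟨φ, hφA, hφB⟩ := exists_hom_of_isHillEquation hAB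
  have hu := isHillEquation_universal (K := K) (n := k + 3) (by omega)
  refine ⟨Fin.snoc (fun l : Fin k => hillMk K (k + 3) (universalB K (k + 3) (l : ℕ)))
    (hillMk K (k + 3) (universalB K (k + 3) ((k + 1 : ℕ) : ℤ))), fun i => ?_, ?_⟩
  · induction i using Fin.lastCases with
    | last => rw [Fin.snoc_last]; exact (hu.1 _).2.1
    | cast l => rw [Fin.snoc_castSucc]; exact (hu.1 _).2.1
  · refine le_ringKrullDim_quotient_evenAnnihilator (hillMkGraded K (k + 3))
      (hillMk_surjective K (k + 3)) φ _ (fun i => ?_)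
      (fun l => ⟨hillMk K (k + 3) (universalA K (k + 3) (l : ℕ)), (hu.1 _).1⟩) x' (fun l => ?_)
      (algebraicIndependent_X_fractionRing K (Fin k))
    · induction i using Fin.lastCases with
      | last => rw [Fin.snoc_last]; exact (hφB _).trans hBθ
      | cast l =>
        rw [Fin.snoc_castSucc]
        refine (hφB _).trans ((hB l l.2).trans ?_)
        exact dif_pos l.2
    · refine (hφA _).trans ((hA l l.2).trans ?_)
      exact dif_pos l.2

theorem hasSuperdimension_hill (n : ℕ) (hn : 3 ≤ n) :
    HasSuperdimension (hillGrading K n) (n - 3) (n - 2) := by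
  obtain ⟨k, rfl⟩ : ∃ k, n = k + 3 := ⟨n - 3, by omega⟩
  exact hasSuperdimension_of_bounds (ringKrullDim_hill_le K (k + 3) hn)
    (exists_le_ringKrullDim_hill_quotient K k)
    fun s hs y hy => ringKrullDim_hill_quotient_ne K (k + 3) hn hs y hy

end HillLower

end

theorem mainTheorem4 (K : Type u) [Field K] (n : ℕ) (hn : 3 ≤ n) :
    (∀ (R : Type v) [Ring R] [Algebra K R] (𝓡 : ZMod 2 → Submodule K R) [GradedAlgebra 𝓡]
        [IsSupercommutative 𝓡],
      Set.BijOn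
        (fun φ : potentialGrading K n →ₐᵍ[K] 𝓡 =>
          ((fun i => φ (universalA K n i), fun i => φ (universalB K n i)) : (ℤ → R) × (ℤ → R)))
        Set.univ {p | IsPotential 𝓡 n p.1 p.2} ∧
      Set.BijOn
        (fun φ : hillGrading K n →ₐᵍ[K] 𝓡 =>
          ((fun i => φ (hillMk K n (universalA K n i)),
            fun i => φ (hillMk K n (universalB K n i))) : (ℤ → R) × (ℤ → R)))
        Set.univ {p | IsHillEquation 𝓡 n p.1 p.2} ∧
      (∀ a β : ℤ → R, IsPotential 𝓡 n a β → ∀ i : ℤ,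
        (IsHillEquation 𝓡 n a β ↔ monodromy a β i n = hillMonodromy R))) ∧
    HasSuperdimension (potentialGrading K n) n n ∧
    HasSuperdimension (hillGrading K n) (n - 3) (n - 2) ∧
    HasSupercodimension (potentialGrading K n) (hillGrading K n) 3 2 := by
  have hn0 : n ≠ 0 := by omega
  have h1 := hasSuperdimension_potential K n hn0
  have h2 := hasSuperdimension_hill K n hn
  refine ⟨fun R _ _ 𝓡 _ _ => ⟨bijOn_potential hn0, bijOn_hill hn0,
    fun a β h i => isHillEquation_iff 𝓡 h i⟩, h1, h2, n - 3, n - 2, ?_, h2⟩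
  rwa [Nat.sub_add_cancel hn, Nat.sub_add_cancel (by omega : 2 ≤ n)]
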